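/- Fix $0<b_1\le b_2$. There are constants $K,C>0$, depending only on $b_1,b_2$, such that the following holds for all $B\in[b_1,b_2]$ (that is, $B=\Theta(1)$), all dimensions $d$, all $T\ge 1$, all $\delta\in(0,\tfrac12]$, all probability measures $p_{\mathsf{data}}$ on $\mathbb R^d$ (no further assumption), and all parameters $\alpha_t\ne 0$, $\eta_t>0$, $0\le t<T$. Let $X_0\sim p_{\mathsf{data}}$ and $X_{t+1}\mid X_t\sim \mathsf N(\alpha_t X_t,\alpha_t^2\eta_t I)$, so that $X_t\mid X_0\sim\mathsf N(\bar\alpha_t X_0,\sigma_t^2 I)$ with $\bar\alpha_t=\prod_{s<t}\alpha_s$, $\sigma_0^2=0$, $\sigma_{t+1}^2=\alpha_t^2(\sigma_t^2+\eta_t)$. Let $p_t$ be the law of $X_t$, and for $t\ge1$ also its smooth density, the Gaussian mixture $p_t(x)=\int (2\pi\sigma_t^2)^{-d/2}e^{-\|x-\bar\alpha_t y\|^2/(2\sigma_t^2)}\,p_{\mathsf{data}}(dy)$. Let $\mathsf s_t:\mathbb R^d\to\mathbb R^d$ be measurable score estimates and $\varepsilon_{\mathsf{score},t}^2=\mathbb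 E_{X_t\sim p_t}\|\mathsf s_t(X_t)-\nabla\log p_t(X_t)\|^2\in[0,\infty]$. Assume $$\frac{\sigma_t^2}{\eta_t}\ \ge\ K\bigl(d\log(1/\delta)+\log^2(1/\delta)\bigr),\qquad 1\le t\le T-1.$$ First-order rejection sampling $\mathsf{FORS}(B,q,(\mathcal W_x)_x)$, with proposal distribution $q$ on $\mathbb R^d$ and estimator distributions $\mathcal W_x$ on $[-B,B]$, repeats the following independent iterations until a point is output: sample $x\sim q$, $J\sim\mathsf{Poisson}(2B)$, and $W_1,\dots,W_J\sim\mathcal W_x$ i.i.d.; output $x$ with probability $\prod_{j=1}^J\frac{B+W_j}{2B}$. Let $\widehat p_T$ be any probability measure on $\mathbb R^d$. Backward diffusion sampling draws $X_T\sim\widehat p_T$ and then, for $t=T-1,\dots,1$, lets $X_t$ be the output of $\mathsf{FORS}(B,q_t,(\mathcal W^t_x)_x)$, where, with $\bar x_t=\alpha_t^{-1}X_{t+1}$, $q_t=\mathsf N(\bar x_t,\eta_t I)$ and $\mathcal W^t_x$ is the law of $\max\{-B,\min\{B,\langle x-\bar x_t,\mathsf s_t(rx+(1-r)\bar x_t)\rangle\}\}$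 for $r\sim\mathsf{Unif}([0,1])$. Then the sampler terminates almost surely, so that the law $\widehat p_1$ of its output $X_1$ is a probability measure, and (with values in $[0,\infty]$) $$\mathrm{KL}(p_1\,\|\,\widehat p_1)\ \le\ C\Bigl(\mathrm{KL}(p_T\,\|\,\widehat p_T)+T\delta+\sum_{t=1}^{T-1}\eta_t\,\varepsilon_{\mathsf{score},t}^2\Bigr).$$ -/

import Mathlib

open MeasureTheory ProbabilityTheory InformationTheory
open scoped ENNReal NNReal

noncomputable section

namespace Diffusion

/-- `ℝ^d` with the Euclidean norm. -/
abbrev Vec (d : ℕ) : Type := EuclideanSpace ℝ (Fin d)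

/-- The isotropic Gaussian `N(m, v I)` on `ℝ^d`. -/
def isoGaussian {d : ℕ} (m : Vec d) (v : ℝ) : Measure (Vec d) :=
  multivariateGaussian m (v • (1 : Matrix (Fin d) (Fin d) ℝ))

/-! ### The forward process -/

/-- The law `p_t` of `X_t` for the Markov chain
`X_0 ∼ pdata`, `X_{t+1} ∣ X_t ∼ N(α_t X_t, α_t² η_t I)`. -/
def forwardLaw {d : ℕ} (α η : ℕ → ℝ) (pdata : Measure (Vec d)) : ℕ → Measure (Vec d)
  | 0 => pdata
  | t + 1 => (forwardLaw α η pdata t).bind fun x => isoGaussian (α t • x) (α t ^ 2 * η t)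

/-- `ᾱ_t = ∏_{s < t} α_s`. -/
def scale (α : ℕ → ℝ) (t : ℕ) : ℝ := ∏ s ∈ Finset.range t, α s

/-- `σ_t²`, with `σ_0² = 0` and `σ_{t+1}² = α_t² (σ_t² + η_t)`, so that
`X_t ∣ X_0 ∼ N(ᾱ_t X_0, σ_t² I)`. -/
def noiseVar (α η : ℕ → ℝ) : ℕ → ℝ
  | 0 => 0
  | t + 1 => α t ^ 2 * (noiseVar α η t + η t)

/-- The (smooth, positive, for `t ≥ 1`) probability density of `X_t`: the average over
`X_0 ∼ pdata` of the density of `N(ᾱ_t X_0, σ_t² I)`. -/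
def forwardDensity {d : ℕ} (α η : ℕ → ℝ) (pdata : Measure (Vec d)) (t : ℕ) (x : Vec d) : ℝ :=
  ∫ y, (Real.sqrt (2 * Real.pi * noiseVar α η t) ^ d)⁻¹ *
    Real.exp (-‖x - scale α t • y‖ ^ 2 / (2 * noiseVar α η t)) ∂pdata

/-- The true score `∇ log p_t`. -/
def score {d : ℕ} (α η : ℕ → ℝ) (pdata : Measure (Vec d)) (t : ℕ) (x : Vec d) : Vec d :=
  gradient (fun y => Real.log (forwardDensity α η pdata t y)) x

/-- The squared score error `E_{X_t ∼ p_t} ‖s_t(X_t) - ∇ log p_t(X_t)‖²` (possibly `∞`). -/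
def scoreErrorSq {d : ℕ} (α η : ℕ → ℝ) (pdata : Measure (Vec d)) (s : ℕ → Vec d → Vec d)
    (t : ℕ) : ℝ≥0∞ :=
  ∫⁻ x, ENNReal.ofReal (‖s t x - score α η pdata t x‖ ^ 2) ∂(forwardLaw α η pdata t)

/-! ### First-order rejection sampling -/

/-- The probability that an iteration which has drawn the point `x` outputs it, `W` being the
estimator distribution at `x`: draw `J ∼ Poisson(2B)`, then `W_1, …, W_J` i.i.d. from `W`, and
accept with probability `∏_{j ≤ J} (B + W_j) / (2B)`. -/
def forsAccept (B : ℝ) (W : Measure ℝ) : ℝ≥0∞ :=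
  ∫⁻ J, ∫⁻ w : Fin J → ℝ, ENNReal.ofReal (∏ j, (B + w j) / (2 * B))
    ∂(Measure.pi fun _ : Fin J => W) ∂(poissonMeasure (2 * B).toNNReal)

/-- For one iteration: the law of the point `x ∼ q` on the event that it is output. -/
def forsHit {d : ℕ} (B : ℝ) (q : Measure (Vec d)) (W : Vec d → Measure ℝ) : Measure (Vec d) :=
  q.withDensity fun x => forsAccept B (W x)

/-- The probability that one iteration outputs nothing. -/
def forsMiss {d : ℕ} (B : ℝ) (q : Measure (Vec d)) (W : Vec d → Measure ℝ) : ℝ≥0∞ :=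
  ∫⁻ x, (1 - forsAccept B (W x)) ∂q

/-- The law of the output of first-order rejection sampling with parameter `B`, proposal `q` and
estimator distributions `W x`. The iterations are independent and the loop stops at the first
output; the `i`-th summand is the law of the output on the event that the first `i` iterations
output nothing and the next one outputs its point. -/
def forsLaw {d : ℕ} (B : ℝ) (q : Measure (Vec d)) (W : Vec d → Measure ℝ) : Measure (Vec d) :=
  Measure.sum fun i : ℕ => forsMiss B q W ^ i • forsHit B q W

/-! ### Backward diffusion sampling -/

/-- `clip_B(a) = max{-B, min{B, a}}`. -/
def clip (B a : ℝ) : ℝ := max (-B) (min B a)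

/-- The law of `clip_B ⟨x - x̄, s(r x + (1 - r) x̄)⟩` for `r ∼ Unif[0,1]`. -/
def lineEstimator {d : ℕ} (B : ℝ) (s : Vec d → Vec d) (xbar x : Vec d) : Measure ℝ :=
  (volume.restrict (Set.Icc (0 : ℝ) 1)).map fun r =>
    clip B (inner ℝ (x - xbar) (s (r • x + (1 - r) • xbar)))

/-- The conditional law of the sampler's `X_t` given `X_{t+1} = x'`: the output of first-order
rejection sampling with proposal `N(x̄, η_t I)`, where `x̄ = α_t⁻¹ x'`, and the clipped
straight-line estimators. -/
def backwardStep {d : ℕ} (B : ℝ) (α η : ℕ → ℝ) (s : ℕ → Vec d → Vec d) (t : ℕ) (x' : Vec d) :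
    Measure (Vec d) :=
  forsLaw B (isoGaussian ((α t)⁻¹ • x') (η t)) (lineEstimator B (s t) ((α t)⁻¹ • x'))

/-- `backwardLaw B α η s μ t k` is the law of the sampler's `X_t` when it is started at time
`t + k` with `X_{t+k} ∼ μ`, and performs the `k` backward steps from `t + k` down to `t`. -/
def backwardLaw {d : ℕ} (B : ℝ) (α η : ℕ → ℝ) (s : ℕ → Vec d → Vec d) (μ : Measure (Vec d)) :
    ℕ → ℕ → Measure (Vec d)
  | _, 0 => μ
  | t, k + 1 => (backwardLaw B α η s μ (t + 1) k).bind (backwardStep B α η s t)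

end Diffusion

end

namespace Diffusion

/-! ### Isotropic Gaussian measures -/

/-! Given the drawn `x`, the acceptance probability is `exp(E W - B)`, by the Poisson generating
function (`forsAccept_eq`). Hence a sampler step has density proportional to `exp(lineMean)` against
its Gaussian proposal. With the exact score and no clipping, `lineMean` would be `log p_t(x) - log
p_t(x̄)`, and the step would be the exact reversal of the forward transition.

Data processing and the chain rule for relative entropy reduce the theorem to the error of one step
(`klDiv_bind_le`). That lemma allows any finite reference measure `n` in place of the first
marginal. In `klDiv_samplerStep_le`, `n` is chosen so that the normalising constant of the rejection
sampler cancels. What remains is the integral of `p_t(x) (Δ + e^{-Δ} - 1)` over `x` and an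
independent Gaussian increment `u`. Here `Δ` is the integral along the segment from `x - u` to `x`
of true minus clipped estimated directional score.

Jensen moves the convex function `y + e^{-y} - 1` inside the segment integral. Translating to the
point `z` of the segment leaves the ratio `ρ = p_t(z + τu) / p_t(z)` as a weight. If `ρ ≤ e^B` and
the true slope `a = ⟨u, ∇ log p_t(z)⟩` is at most `B` in modulus, clipping only helps and the
squared score error dominates. Otherwise an `m`-th moment bound gains `e^{-mB}`
(`mul_expDefect_sub_clip_le`).

The moments of `ρ` and `e^{±a}` need no assumption on the data. A mixture of Gaussians of variance
`v` has `log p + ‖·‖²/(2v)` convex, so exponential tilts of `p` are bounded by translates of `p`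
times `exp(m²‖u‖²/(2v))` (`gaussMix_mul_exp_inner_score_le`, `gaussMix_mul_ratio_pow_le`).
Translates have mass one, and the Gaussian average of the prefactor is at most `exp(m² η d / v)`.
With `m` of order `log(1/δ)`, the noise hypothesis makes the tail at most `δ`. -/

instance isProbabilityMeasure_isoGaussian {d : ℕ} (m : Vec d) (v : ℝ) :
    IsProbabilityMeasure (isoGaussian m v) := by
  unfold isoGaussian; infer_instance

lemma charFun_isoGaussian {d : ℕ} (m : Vec d) {v : ℝ} (hv : 0 ≤ v) (t : Vec d) :
    charFun (isoGaussian m v) t =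
      Complex.exp ((inner ℝ t m : ℝ) * Complex.I - ((v * ‖t‖ ^ 2 / 2 : ℝ) : ℂ)) := by
  have hS : (v • (1 : Matrix (Fin d) (Fin d) ℝ)).PosSemidef := Matrix.PosSemidef.one.smul hv
  rw [isoGaussian, charFun_multivariateGaussian hS]
  congr 2
  rw [EuclideanSpace.real_norm_sq_eq]
  simp [Matrix.smul_mulVec, dotProduct, pow_two, Finset.mul_sum, mul_left_comm]

lemma isoGaussian_eq_map_add {d : ℕ} (m : Vec d) {v : ℝ} (hv : 0 ≤ v) :
    isoGaussian m v = (isoGaussian 0 v).map (fun u => m + u) := by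
  have : IsProbabilityMeasure ((isoGaussian (0 : Vec d) v).map (fun u => m + u)) :=
    Measure.isProbabilityMeasure_map (by fun_prop)
  apply Measure.ext_of_charFun
  ext t
  rw [charFun_map_const_add, charFun_isoGaussian _ hv, charFun_isoGaussian _ hv, ← Complex.exp_add,
    real_inner_comm]
  congr 1
  simp
  ring

/-- By symmetry the noise may enter with a minus sign, so that `x - u` is the base point of the
backward proposal and `u` its increment. -/
lemma isoGaussian_smul_eq_map_sub {d : ℕ} (a : ℝ) (x : Vec d) {h : ℝ} (hh : 0 ≤ h) :
    isoGaussian (a • x) (a ^ 2 * h) = (isoGaussian 0 h).map (fun u => a • (x - u)) := by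
  have : IsProbabilityMeasure ((isoGaussian (0 : Vec d) h).map (fun u => a • (x - u))) :=
    Measure.isProbabilityMeasure_map (by fun_prop)
  apply Measure.ext_of_charFun
  ext t
  have h1 : (fun u : Vec d => a • (x - u)) = (fun u => a • x + u) ∘ (fun u => (-a) • u) := by
    ext1 u; simp [sub_eq_add_neg]
  rw [h1, ← Measure.map_map (by fun_prop) (by fun_prop), charFun_map_const_add, charFun_map_smul,
    charFun_isoGaussian _ (by positivity), charFun_isoGaussian _ hh, ← Complex.exp_add,
    real_inner_comm, norm_smul, mul_pow]
  congr 1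
  simp
  ring

lemma isoGaussian_map_neg {d : ℕ} {v : ℝ} (hv : 0 ≤ v) :
    (isoGaussian (0 : Vec d) v).map (fun u => -u) = isoGaussian 0 v := by
  have := isoGaussian_smul_eq_map_sub (1 : ℝ) (0 : Vec d) hv
  simpa using this.symm

lemma isoGaussian_zero_var {d : ℕ} (m : Vec d) : isoGaussian m 0 = Measure.dirac m := by
  apply Measure.ext_of_charFun
  ext t
  rw [charFun_isoGaussian _ le_rfl, charFun_dirac]
  simp [real_inner_comm]

lemma measurable_isoGaussian {d : ℕ} {v : ℝ} (hv : 0 ≤ v) :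
    Measurable (fun m : Vec d => isoGaussian m v) := by
  refine Measure.measurable_of_measurable_coe _ fun s hs => ?_
  have h : ∀ m : Vec d, isoGaussian m v s = ∫⁻ u, s.indicator 1 (m + u) ∂(isoGaussian 0 v) := by
    intro m
    rw [isoGaussian_eq_map_add m hv, ← lintegral_indicator_one hs, lintegral_map
      (measurable_one.indicator hs) (by fun_prop)]
  simp_rw [h]
  refine Measurable.lintegral_prod_right' (f := fun q : Vec d × Vec d => s.indicator 1 (q.1 + q.2)) ?_
  exact (measurable_one.indicator hs).comp (by fun_prop)

/-- Adding independent Gaussian noise and rescaling. -/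
lemma isoGaussian_bind {d : ℕ} (m : Vec d) {v h : ℝ} (hv : 0 ≤ v) (hh : 0 ≤ h) (a : ℝ) :
    (isoGaussian m v).bind (fun x => isoGaussian (a • x) (a ^ 2 * h)) =
      isoGaussian (a • m) (a ^ 2 * (v + h)) := by
  have hmeas : Measurable fun x : Vec d => isoGaussian (a • x) (a ^ 2 * h) :=
    (measurable_isoGaussian (by positivity)).comp (by fun_prop)
  have key : (isoGaussian m v).bind (fun x => isoGaussian (a • x) (a ^ 2 * h)) =
      (isoGaussian (a • m) (a ^ 2 * v)) ∗ (isoGaussian 0 (a ^ 2 * h)) := by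
    have hm : isoGaussian (a • m) (a ^ 2 * v) = (isoGaussian m v).map (fun x => a • x) := by
      rw [isoGaussian_smul_eq_map_sub _ _ hv, isoGaussian_eq_map_add m hv,
        Measure.map_map (by fun_prop) (by fun_prop)]
      nth_rw 2 [← isoGaussian_map_neg hv]
      rw [Measure.map_map (by fun_prop) (by fun_prop)]
      congr 1
    have : IsProbabilityMeasure ((isoGaussian m v).map (fun x => a • x)) :=
      Measure.isProbabilityMeasure_map (by fun_prop)
    refine Measure.ext_of_lintegral _ fun f hf => ?_
    rw [Measure.lintegral_bind hmeas.aemeasurable hf.aemeasurable, hm, Measure.lintegral_conv hf,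
      lintegral_map (Measurable.lintegral_prod_right'
        (f := fun q : Vec d × Vec d => f (q.1 + q.2)) (by fun_prop)) (by fun_prop)]
    refine lintegral_congr fun x => ?_
    rw [isoGaussian_eq_map_add _ (by positivity), lintegral_map hf (by fun_prop)]
  rw [key]
  apply Measure.ext_of_charFun
  ext t
  rw [charFun_conv, charFun_isoGaussian _ (by positivity), charFun_isoGaussian _ (by positivity),
    charFun_isoGaussian _ (by positivity), ← Complex.exp_add]
  congr 1
  simp
  ring

/-- The density of `N(0, v I)` on `ℝ^d`. -/
noncomputable def gaussDensity {d : ℕ} (v : ℝ) (x : Vec d) : ℝ :=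
  (Real.sqrt (2 * Real.pi * v) ^ d)⁻¹ * Real.exp (-‖x‖ ^ 2 / (2 * v))

/-! ### Density and moments of the isotropic Gaussian. -/

lemma sqrt_pow_eq_rpow {x : ℝ} (hx : 0 < x) (d : ℕ) :
    Real.sqrt x ^ d = x ^ ((d : ℝ) / 2) := by
  rw [Real.sqrt_eq_rpow, ← Real.rpow_natCast, ← Real.rpow_mul hx.le]
  congr 1; ring

lemma gaussDensity_pos {d : ℕ} {v : ℝ} (hv : 0 < v) (x : Vec d) : 0 < gaussDensity v x := by
  unfold gaussDensity; positivity

lemma measurable_gaussDensity {d : ℕ} (v : ℝ) : Measurable (gaussDensity (d := d) v) := by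
  unfold gaussDensity; fun_prop

lemma integrable_exp_neg_mul_sq_norm {d : ℕ} {b : ℝ} (hb : 0 < b) :
    Integrable (fun x : Vec d => Real.exp (-b * ‖x‖ ^ 2)) := by
  refine Integrable.of_integral_ne_zero ?_
  rw [GaussianFourier.integral_rexp_neg_mul_sq_norm hb]
  positivity

lemma gaussDensity_eq {d : ℕ} (v : ℝ) (x : Vec d) :
    gaussDensity v x = (Real.sqrt (2 * Real.pi * v) ^ d)⁻¹ * Real.exp (-(1 / (2 * v)) * ‖x‖ ^ 2) := by
  unfold gaussDensity; congr 2; ring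

lemma integrable_gaussDensity {d : ℕ} {v : ℝ} (hv : 0 < v) :
    Integrable (gaussDensity (d := d) v) := by
  simp_rw [funext (gaussDensity_eq (d := d) v)]
  exact (integrable_exp_neg_mul_sq_norm (by positivity)).const_mul _

lemma integral_gaussDensity {d : ℕ} {v : ℝ} (hv : 0 < v) :
    ∫ x, gaussDensity (d := d) v x = 1 := by
  simp_rw [gaussDensity_eq]
  rw [integral_const_mul, GaussianFourier.integral_rexp_neg_mul_sq_norm (by positivity),
    sqrt_pow_eq_rpow (by positivity), finrank_euclideanSpace, Fintype.card_fin,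
    show Real.pi / (1 / (2 * v)) = 2 * Real.pi * v by field_simp]
  exact inv_mul_cancel₀ (by positivity)

lemma lintegral_gaussDensity {d : ℕ} {v : ℝ} (hv : 0 < v) :
    ∫⁻ x, ENNReal.ofReal (gaussDensity (d := d) v x) = 1 := by
  rw [← ofReal_integral_eq_lintegral_ofReal (integrable_gaussDensity hv)
    (ae_of_all _ fun x => (gaussDensity_pos hv x).le), integral_gaussDensity hv, ENNReal.ofReal_one]

lemma isoGaussian_zero_eq_withDensity {d : ℕ} {v : ℝ} (hv : 0 < v) :
    isoGaussian (0 : Vec d) v = volume.withDensity fun x => ENNReal.ofReal (gaussDensity v x) := by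
  have hp : IsProbabilityMeasure
      (volume.withDensity fun x : Vec d => ENNReal.ofReal (gaussDensity v x)) :=
    ⟨by rw [withDensity_apply _ MeasurableSet.univ, Measure.restrict_univ,
      lintegral_gaussDensity hv]⟩
  apply Measure.ext_of_charFun
  ext t
  rw [charFun_isoGaussian _ hv.le, charFun_apply, integral_withDensity_eq_integral_toReal_smul
    (measurable_gaussDensity v).ennreal_ofReal (ae_of_all _ fun _ => ENNReal.ofReal_lt_top)]
  have h1 : ∀ x : Vec d, (ENNReal.ofReal (gaussDensity v x)).toReal •
      Complex.exp (((inner ℝ x t : ℝ) : ℂ) * Complex.I) =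
      (((Real.sqrt (2 * Real.pi * v) ^ d)⁻¹ : ℝ) : ℂ) *
        Complex.exp (-((1 / (2 * v) : ℝ) : ℂ) * (‖x‖ : ℂ) ^ 2 + Complex.I * (inner ℝ t x : ℝ)) := by
    intro x
    rw [ENNReal.toReal_ofReal (gaussDensity_pos hv x).le, gaussDensity_eq, Complex.real_smul,
      Complex.ofReal_mul, mul_assoc, Complex.ofReal_exp, ← Complex.exp_add, real_inner_comm]
    congr 2
    push_cast
    ring
  simp_rw [h1]
  rw [integral_const_mul, GaussianFourier.integral_cexp_neg_mul_sq_norm_add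
    (by rw [Complex.ofReal_re]; positivity), finrank_euclideanSpace, Fintype.card_fin,
    sqrt_pow_eq_rpow (by positivity), ← mul_assoc,
    show (Real.pi : ℂ) / ((1 / (2 * v) : ℝ) : ℂ) = ((2 * Real.pi * v : ℝ) : ℂ) by
      push_cast; field_simp,
    show ((d : ℂ) / 2) = (((d : ℝ) / 2 : ℝ) : ℂ) by push_cast; rfl,
    ← Complex.ofReal_cpow (by positivity), ← Complex.ofReal_mul,
    inv_mul_cancel₀ (by positivity), Complex.ofReal_one, one_mul]
  congr 1
  have : (v : ℂ) ≠ 0 := by exact_mod_cast hv.ne'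
  simp
  field_simp
  norm_num

lemma isoGaussian_eq_withDensity {d : ℕ} (m : Vec d) {v : ℝ} (hv : 0 < v) :
    isoGaussian m v = volume.withDensity fun x => ENNReal.ofReal (gaussDensity v (x - m)) := by
  refine Measure.ext_of_lintegral _ fun f hf => ?_
  rw [isoGaussian_eq_map_add m hv.le, lintegral_map hf (by fun_prop),
    isoGaussian_zero_eq_withDensity hv,
    lintegral_withDensity_eq_lintegral_mul _ (measurable_gaussDensity v).ennreal_ofReal
      (by fun_prop),
    lintegral_withDensity_eq_lintegral_mul (f := fun x => ENNReal.ofReal (gaussDensity v (x - m))) _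
      ((measurable_gaussDensity v).comp (measurable_id.sub_const m)).ennreal_ofReal hf,
    ← lintegral_add_left_eq_self ((fun x => ENNReal.ofReal (gaussDensity v (x - m))) * f) m]
  simp

/-- The exponential moment of the squared norm of a Gaussian vector. -/
lemma lintegral_exp_sq_norm_isoGaussian_le {d : ℕ} {h c : ℝ} (hh : 0 < h) (hc : 0 ≤ c)
    (hch : 2 * c * h ≤ 1 / 2) :
    ∫⁻ u, ENNReal.ofReal (Real.exp (c * ‖u‖ ^ 2)) ∂(isoGaussian (0 : Vec d) h) ≤
      ENNReal.ofReal (Real.exp (2 * c * h * d)) := by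
  rw [isoGaussian_zero_eq_withDensity hh, lintegral_withDensity_eq_lintegral_mul _
    (measurable_gaussDensity h).ennreal_ofReal (by fun_prop)]
  have hb : 0 < 1 / (2 * h) - c := by
    rw [sub_pos, lt_div_iff₀ (by positivity)]; linarith
  have h1 : ∀ u : Vec d, ENNReal.ofReal (gaussDensity h u) * ENNReal.ofReal (Real.exp (c * ‖u‖ ^ 2))
      = ENNReal.ofReal ((Real.sqrt (2 * Real.pi * h) ^ d)⁻¹ *
        Real.exp (-(1 / (2 * h) - c) * ‖u‖ ^ 2)) := by
    intro u
    rw [← ENNReal.ofReal_mul (gaussDensity_pos hh u).le, gaussDensity_eq, mul_assoc, ← Real.exp_add]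
    congr 3; ring
  simp only [Pi.mul_apply, h1]
  rw [← ofReal_integral_eq_lintegral_ofReal ((integrable_exp_neg_mul_sq_norm hb).const_mul _)
    (ae_of_all _ fun x => by positivity), integral_const_mul,
    GaussianFourier.integral_rexp_neg_mul_sq_norm hb, sqrt_pow_eq_rpow (by positivity),
    finrank_euclideanSpace, Fintype.card_fin]
  apply ENNReal.ofReal_le_ofReal
  rw [← Real.inv_rpow (by positivity), ← Real.mul_rpow (by positivity) (by positivity)]
  have h2 : (2 * Real.pi * h)⁻¹ * (Real.pi / (1 / (2 * h) - c)) = (1 - 2 * c * h)⁻¹ := by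
    have : 1 - 2 * c * h ≠ 0 := by linarith
    have h3 : 1 / (2 * h) - c = (1 - 2 * c * h) / (2 * h) := by field_simp
    rw [h3]; field_simp
  -- For `x = 2ch` in `[0, 1/2]`, `(1 - x)(1 + 2x) ≥ 1`, hence `(1 - x)⁻¹ ≤ e^{2x}`.
  have h4 : (1 - 2 * c * h)⁻¹ ≤ Real.exp (2 * (2 * c * h)) := by
    have hx : 0 ≤ 2 * c * h := by positivity
    rw [inv_le_iff_one_le_mul₀ (by linarith)]
    have := Real.add_one_le_exp (2 * (2 * c * h))
    nlinarith
  rw [h2]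
  calc ((1 - 2 * c * h)⁻¹) ^ ((d : ℝ) / 2) ≤ (Real.exp (2 * (2 * c * h))) ^ ((d : ℝ) / 2) :=
        Real.rpow_le_rpow (inv_nonneg.2 (by linarith)) h4 (by positivity)
    _ = _ := by rw [← Real.exp_mul]; congr 1; ring

/-- Isotropy: averaging over the increment turns the directional score error into the full norm with
factor `h`, without a factor `d`. -/
lemma lintegral_inner_sq_isoGaussian {d : ℕ} {h : ℝ} (hh : 0 ≤ h) (e : Vec d) :
    ∫⁻ u, ENNReal.ofReal (inner ℝ u e ^ 2) ∂(isoGaussian (0 : Vec d) h) =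
      ENNReal.ofReal (h * ‖e‖ ^ 2) := by
  have hS : (h • (1 : Matrix (Fin d) (Fin d) ℝ)).PosSemidef := Matrix.PosSemidef.one.smul hh
  have : IsGaussian (isoGaussian (0 : Vec d) h) := by unfold isoGaussian; infer_instance
  have hL : MemLp (fun u : Vec d => inner ℝ u e) 2 (isoGaussian (0 : Vec d) h) := by
    have := IsGaussian.memLp_dual (isoGaussian (0 : Vec d) h) (innerSL ℝ e) 2 (by simp)
    simpa [real_inner_comm] using this
  have h0 : ∫ u, inner ℝ e u ∂(isoGaussian (0 : Vec d) h) = 0 := by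
    rw [integral_inner IsGaussian.integrable_fun_id]
    simp [isoGaussian]
  have h1 : ∫ u, inner ℝ u e ^ 2 ∂(isoGaussian (0 : Vec d) h) = h * ‖e‖ ^ 2 := by
    have h2 := covarianceBilin_multivariateGaussian (μ := (0 : Vec d)) hS e e
    have h3 : IsGaussian (multivariateGaussian (0 : Vec d) (h • (1 : Matrix (Fin d) (Fin d) ℝ))) :=
      inferInstance
    rw [covarianceBilin_apply_eq_cov IsGaussian.memLp_two_id, covariance] at h2
    change ∫ u, (inner ℝ e u - ∫ u, inner ℝ e u ∂(isoGaussian (0 : Vec d) h)) *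
      (inner ℝ e u - ∫ u, inner ℝ e u ∂(isoGaussian (0 : Vec d) h)) ∂(isoGaussian (0 : Vec d) h)
        = _ at h2
    simp only [h0, sub_zero] at h2
    simp_rw [pow_two, real_inner_comm e]
    rw [h2, ← pow_two, EuclideanSpace.real_norm_sq_eq]
    simp [Matrix.smul_mulVec, dotProduct, pow_two, Finset.mul_sum, mul_left_comm]
  rw [← h1, ofReal_integral_eq_lintegral_ofReal hL.integrable_sq
    (ae_of_all _ fun _ => sq_nonneg _)]

/-! ### Gaussian mixtures -/

/-- The gradient of the Gaussian density. -/
noncomputable def gaussGrad {d : ℕ} (v : ℝ) (x : Vec d) : Vec d := (-(gaussDensity v x / v)) • x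

lemma hasFDerivAt_gaussDensity {d : ℕ} (v : ℝ) (x : Vec d) :
    HasFDerivAt (gaussDensity v) (innerSL ℝ (gaussGrad v x)) x := by
  have h1 : HasFDerivAt (fun x : Vec d => -‖x‖ ^ 2 / (2 * v))
      ((-(2 * v)⁻¹) • ((2 : ℝ) • innerSL ℝ x)) x := by
    have := (hasStrictFDerivAt_norm_sq x).hasFDerivAt.const_mul (-(2 * v)⁻¹)
    simp only [two_nsmul, ← two_smul ℝ] at this
    refine this.congr_of_eventuallyEq (Filter.Eventually.of_forall fun y => ?_)
    simp only; ring
  have h2 := (h1.exp).const_mul ((Real.sqrt (2 * Real.pi * v) ^ d)⁻¹)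
  refine h2.congr_fderiv ?_
  ext y
  simp only [gaussGrad, gaussDensity, smul_smul, map_smul]
  simp only [FunLike.coe_smul, Pi.smul_apply, smul_eq_mul]
  ring

lemma continuous_gaussDensity {d : ℕ} (v : ℝ) : Continuous (gaussDensity (d := d) v) := by
  unfold gaussDensity; fun_prop

lemma continuous_gaussGrad {d : ℕ} (v : ℝ) : Continuous (gaussGrad (d := d) v) := by
  unfold gaussGrad
  have := continuous_gaussDensity (d := d) v
  fun_prop

lemma gaussDensity_le {d : ℕ} {v : ℝ} (hv : 0 < v) (x : Vec d) :
    gaussDensity v x ≤ (Real.sqrt (2 * Real.pi * v) ^ d)⁻¹ := by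
  unfold gaussDensity
  refine mul_le_of_le_one_right (by positivity) (Real.exp_le_one_iff.2 ?_)
  rw [neg_div]
  have : 0 ≤ ‖x‖ ^ 2 / (2 * v) := by positivity
  linarith

/-- A bound uniform in `x` suffices to differentiate under any probability measure, so the mixing
law needs no moments. -/
lemma norm_gaussGrad_le {d : ℕ} {v : ℝ} (hv : 0 < v) (x : Vec d) :
    ‖gaussGrad v x‖ ≤ (Real.sqrt (2 * Real.pi * v) ^ d)⁻¹ * ((1 + v) / v) := by
  have hexp : Real.exp (-‖x‖ ^ 2 / (2 * v)) * ‖x‖ ≤ 1 + v := by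
    rw [neg_div, Real.exp_neg, inv_mul_le_iff₀ (Real.exp_pos _)]
    have h1 := Real.add_one_le_exp (‖x‖ ^ 2 / (2 * v))
    have h2 : ‖x‖ ≤ ‖x‖ ^ 2 / (2 * v) + v / 2 := by
      have : ‖x‖ ^ 2 / (2 * v) + v / 2 - ‖x‖ = (‖x‖ - v) ^ 2 / (2 * v) := by field_simp; ring
      have : 0 ≤ (‖x‖ - v) ^ 2 / (2 * v) := by positivity
      linarith
    have h3 : 0 ≤ ‖x‖ ^ 2 / (2 * v) := by positivity
    nlinarith
  rw [gaussGrad, norm_smul, Real.norm_eq_abs, abs_neg,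
    abs_of_pos (div_pos (gaussDensity_pos hv x) hv), gaussDensity]
  calc _ = (Real.sqrt (2 * Real.pi * v) ^ d)⁻¹ * ((Real.exp (-‖x‖ ^ 2 / (2 * v)) * ‖x‖) / v) := by
        ring
    _ ≤ _ := by gcongr

/-- The density of the convolution of `P` with `N(0, v I)`. -/
noncomputable def gaussMix {d : ℕ} (P : Measure (Vec d)) (v : ℝ) (x : Vec d) : ℝ :=
  ∫ y, gaussDensity v (x - y) ∂P

/-- The score of `gaussMix`. -/
noncomputable def gaussMixScore {d : ℕ} (P : Measure (Vec d)) (v : ℝ) (x : Vec d) : Vec d :=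
  gradient (fun y => Real.log (gaussMix P v y)) x

section Mix

variable {d : ℕ} (P : Measure (Vec d)) [IsProbabilityMeasure P] {v : ℝ} (hv : 0 < v)
include hv

lemma integrable_gaussDensity_sub (x : Vec d) : Integrable (fun y => gaussDensity v (x - y)) P :=
  Integrable.of_bound ((continuous_gaussDensity v).comp (by fun_prop)).aestronglyMeasurable _
    (ae_of_all _ fun y => by
      rw [Real.norm_of_nonneg (gaussDensity_pos hv _).le]; exact gaussDensity_le hv _)

lemma integrable_gaussGrad_sub (x : Vec d) : Integrable (fun y => gaussGrad v (x - y)) P :=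
  Integrable.of_bound ((continuous_gaussGrad v).comp (by fun_prop)).aestronglyMeasurable _
    (ae_of_all _ fun y => norm_gaussGrad_le hv _)

lemma gaussMix_pos (x : Vec d) : 0 < gaussMix P v x :=
  (integral_pos_iff_support_of_nonneg (fun y => (gaussDensity_pos hv _).le)
    (integrable_gaussDensity_sub P hv x)).2 (by
      rw [Function.support_eq_univ fun y => (gaussDensity_pos hv (x - y)).ne']; simp)

lemma hasFDerivAt_gaussMix (x : Vec d) :
    HasFDerivAt (gaussMix P v) (innerSL ℝ (∫ y, gaussGrad v (x - y) ∂P)) x := by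
  have h := hasFDerivAt_integral_of_dominated_of_fderiv_le (μ := P) (𝕜 := ℝ)
    (F := fun x y => gaussDensity v (x - y)) (x₀ := x) (s := Set.univ)
    (F' := fun x y => innerSL ℝ (gaussGrad v (x - y)))
    (bound := fun _ => (Real.sqrt (2 * Real.pi * v) ^ d)⁻¹ * ((1 + v) / v)) Filter.univ_mem
    (Filter.Eventually.of_forall fun x =>
      ((continuous_gaussDensity v).comp (by fun_prop)).aestronglyMeasurable)
    (integrable_gaussDensity_sub P hv x)
    ((innerSL ℝ).continuous.comp
      ((continuous_gaussGrad v).comp (by fun_prop))).aestronglyMeasurable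
    (ae_of_all _ fun y x _ => by
      rw [innerSL_apply_norm]; exact norm_gaussGrad_le hv _)
    (integrable_const _)
    (ae_of_all _ fun y x _ => (hasFDerivAt_comp_sub y).2 (hasFDerivAt_gaussDensity v (x - y)))
  rwa [ContinuousLinearMap.integral_comp_comm _ (integrable_gaussGrad_sub P hv x)] at h

lemma continuous_gaussMix : Continuous (gaussMix P v) :=
  continuous_iff_continuousAt.2 fun x => (hasFDerivAt_gaussMix P hv x).continuousAt

lemma hasFDerivAt_log_gaussMix (x : Vec d) :
    HasFDerivAt (fun y => Real.log (gaussMix P v y))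
      (innerSL ℝ ((gaussMix P v x)⁻¹ • ∫ y, gaussGrad v (x - y) ∂P)) x := by
  rw [map_smul]
  exact (hasFDerivAt_gaussMix P hv x).log (gaussMix_pos P hv x).ne'

lemma gaussMixScore_eq (x : Vec d) :
    gaussMixScore P v x = (gaussMix P v x)⁻¹ • ∫ y, gaussGrad v (x - y) ∂P :=
  HasGradientAt.gradient (hasFDerivAt_log_gaussMix P hv x)

lemma continuous_gaussMixScore : Continuous (gaussMixScore P v) := by
  rw [funext (gaussMixScore_eq P hv)]
  refine ((continuous_gaussMix P hv).inv₀ fun x => (gaussMix_pos P hv x).ne').smul ?_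
  exact continuous_of_dominated
    (fun x => ((continuous_gaussGrad v).comp (by fun_prop)).aestronglyMeasurable)
    (fun x => ae_of_all _ fun y => norm_gaussGrad_le hv _) (integrable_const _)
    (ae_of_all _ fun y => (continuous_gaussGrad v).comp (by fun_prop))

lemma hasFDerivAt_log_gaussMix_score (x : Vec d) :
    HasFDerivAt (fun y => Real.log (gaussMix P v y)) (innerSL ℝ (gaussMixScore P v x)) x := by
  rw [gaussMixScore_eq P hv]; exact hasFDerivAt_log_gaussMix P hv x

/-- Convexity of `log (gaussMix P v) + ‖·‖² / (2 v)`, as a tangent inequality. -/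
lemma gaussMix_mul_exp_inner_score_le (z w : Vec d) :
    gaussMix P v z * Real.exp (inner ℝ w (gaussMixScore P v z)) ≤
      Real.exp (‖w‖ ^ 2 / (2 * v)) * gaussMix P v (z + w) := by
  -- `m` is the posterior mean of `-⟨w, z - y⟩ / v` given `z`. The tangent line of `exp` at `m`
  -- therefore has no linear term after integration: this is Jensen for the posterior.
  set m := inner ℝ w (gaussMixScore P v z) with hm
  have hpz := gaussMix_pos P hv z
  have hmz : gaussMix P v z * m = ∫ y, inner ℝ w (gaussGrad v (z - y)) ∂P := by
    rw [hm, gaussMixScore_eq P hv, integral_inner (integrable_gaussGrad_sub P hv z),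
      real_inner_smul_right]
    field_simp
  have hpt : ∀ y, Real.exp m * (gaussDensity v (z - y) * (1 - m) + inner ℝ w (gaussGrad v (z - y)))
      ≤ Real.exp (‖w‖ ^ 2 / (2 * v)) * gaussDensity v (z + w - y) := by
    intro y
    have e1 : Real.exp (‖w‖ ^ 2 / (2 * v)) * gaussDensity v (z + w - y) =
        Real.exp (-(inner ℝ w (z - y) / v)) * gaussDensity v (z - y) := by
      unfold gaussDensity
      rw [show z + w - y = w + (z - y) by abel, norm_add_sq_real, mul_left_comm, ← Real.exp_add,
        mul_left_comm, ← Real.exp_add]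
      congr 2
      field_simp; ring
    rw [e1, gaussGrad, real_inner_smul_right]
    have h2 := Real.add_one_le_exp (-(inner ℝ w (z - y) / v) - m)
    have h3 : Real.exp (-(inner ℝ w (z - y) / v)) =
        Real.exp m * Real.exp (-(inner ℝ w (z - y) / v) - m) := by
      rw [← Real.exp_add]; congr 1; ring
    rw [h3, mul_assoc]
    refine mul_le_mul_of_nonneg_left ?_ (Real.exp_pos _).le
    calc _ = (-(inner ℝ w (z - y) / v) - m + 1) * gaussDensity v (z - y) := by ring
      _ ≤ _ := mul_le_mul_of_nonneg_right h2 (gaussDensity_pos hv _).le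
  have hi1 := integrable_gaussDensity_sub P hv z
  have hi2 : Integrable (fun y => inner ℝ w (gaussGrad v (z - y))) P :=
    (integrable_gaussGrad_sub P hv z).const_inner w
  have hint := integral_mono (((hi1.mul_const (1 - m)).add hi2).const_mul (Real.exp m))
    ((integrable_gaussDensity_sub P hv (z + w)).const_mul (Real.exp (‖w‖ ^ 2 / (2 * v)))) hpt
  simp only [Pi.add_apply] at hint
  rw [integral_const_mul, integral_const_mul, integral_add (hi1.mul_const _) hi2,
    integral_mul_const, ← hmz] at hint
  change Real.exp m * (gaussMix P v z * (1 - m) + gaussMix P v z * m) ≤ _ at hint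
  calc _ = Real.exp m * (gaussMix P v z * (1 - m) + gaussMix P v z * m) := by ring
    _ ≤ _ := hint

/-- The moments of the likelihood ratio of a shift. -/
lemma gaussMix_mul_ratio_pow_le (z w : Vec d) (m : ℕ) (hm : 1 ≤ m) :
    gaussMix P v z * (gaussMix P v (z + w) / gaussMix P v z) ^ m ≤
      Real.exp ((m : ℝ) ^ 2 * ‖w‖ ^ 2 / (2 * v)) * gaussMix P v (z + (m : ℝ) • w) := by
  obtain ⟨k, rfl⟩ : ∃ k, m = k + 1 := ⟨m - 1, by omega⟩
  have hp := gaussMix_pos P hv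
  -- Both tangent inequalities are based at `z + w`: the one towards `z` is raised to the power `k`,
  -- the other goes towards `z + (k+1)w`. In their product the score terms cancel, and the Gaussian
  -- exponents add to `k + k² ≤ (k+1)²` times `‖w‖²/(2v)`.
  have h1 := gaussMix_mul_exp_inner_score_le P hv (z + w) (-w)
  have h2 := gaussMix_mul_exp_inner_score_le P hv (z + w) ((k : ℝ) • w)
  rw [show z + w + -w = z by abel, norm_neg, inner_neg_left] at h1
  rw [show z + w + (k : ℝ) • w = z + ((k + 1 : ℕ) : ℝ) • w by push_cast; module, norm_smul,
    real_inner_smul_left, Real.norm_natCast] at h2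
  set s := inner ℝ w (gaussMixScore P v (z + w))
  set E := Real.exp (‖w‖ ^ 2 / (2 * v))
  have h3 := pow_le_pow_left₀ (mul_pos (hp (z + w)) (Real.exp_pos _)).le h1 k
  have h4 := mul_le_mul h3 h2 (mul_pos (hp (z + w)) (Real.exp_pos _)).le
    (pow_nonneg (mul_pos (Real.exp_pos _) (hp z)).le k)
  have e1 : Real.exp (-s) ^ k * Real.exp (k * s) = 1 := by
    rw [← Real.exp_nat_mul, ← Real.exp_add]; simp
  have e2 : (gaussMix P v (z + w) * Real.exp (-s)) ^ k * (gaussMix P v (z + w) * Real.exp (k * s)) =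
      gaussMix P v (z + w) ^ (k + 1) := by
    calc _ = gaussMix P v (z + w) ^ (k + 1) * (Real.exp (-s) ^ k * Real.exp (k * s)) := by ring
      _ = _ := by rw [e1, mul_one]
  rw [e2, mul_pow] at h4
  rw [div_pow, ← mul_div_assoc, div_le_iff₀ (pow_pos (hp z) _), pow_succ (gaussMix P v z)]
  have e3 : E ^ k * Real.exp ((k * ‖w‖) ^ 2 / (2 * v)) ≤
      Real.exp (((k + 1 : ℕ) : ℝ) ^ 2 * ‖w‖ ^ 2 / (2 * v)) := by
    rw [← Real.exp_nat_mul, ← Real.exp_add]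
    refine Real.exp_le_exp.2 ?_
    rw [← mul_div_assoc, ← add_div]
    gcongr
    push_cast
    nlinarith [sq_nonneg ‖w‖, (Nat.cast_nonneg k : (0:ℝ) ≤ k)]
  calc gaussMix P v z * gaussMix P v (z + w) ^ (k + 1)
      ≤ gaussMix P v z * (E ^ k * gaussMix P v z ^ k *
        (Real.exp ((k * ‖w‖) ^ 2 / (2 * v)) * gaussMix P v (z + ((k + 1 : ℕ) : ℝ) • w))) :=
        mul_le_mul_of_nonneg_left h4 (hp z).le
    _ = (E ^ k * Real.exp ((k * ‖w‖) ^ 2 / (2 * v))) *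
        (gaussMix P v (z + ((k + 1 : ℕ) : ℝ) • w) * (gaussMix P v z ^ k * gaussMix P v z)) := by ring
    _ ≤ _ := by
        rw [mul_assoc (Real.exp (((k + 1 : ℕ) : ℝ) ^ 2 * ‖w‖ ^ 2 / (2 * v)))]
        exact mul_le_mul_of_nonneg_right e3
          (mul_pos (hp _) (mul_pos (pow_pos (hp z) k) (hp z))).le

/-- The log-density increment as a line integral of the score. -/
lemma log_gaussMix_sub_eq_integral (x u : Vec d) :
    Real.log (gaussMix P v x) - Real.log (gaussMix P v (x - u)) =
      ∫ r in Set.Icc (0 : ℝ) 1, inner ℝ u (gaussMixScore P v (x - (1 - r) • u)) := by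
  have hc := continuous_gaussMixScore P hv
  have hd : ∀ r ∈ Set.uIcc (0 : ℝ) 1,
      HasDerivAt (fun r : ℝ => Real.log (gaussMix P v (x - (1 - r) • u)))
        (inner ℝ u (gaussMixScore P v (x - (1 - r) • u))) r := by
    intro r _
    have h1 : HasDerivAt (fun r : ℝ => x - (1 - r) • u) u r := by
      have := (((hasDerivAt_id r).const_sub 1).smul_const u).const_sub x
      simpa using this
    have := (hasFDerivAt_log_gaussMix_score P hv (x - (1 - r) • u)).comp_hasDerivAt r h1
    rw [real_inner_comm]
    exact this
  have := intervalIntegral.integral_eq_sub_of_hasDerivAt hd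
    (Continuous.intervalIntegrable (by fun_prop) _ _)
  rw [integral_Icc_eq_integral_Ioc, ← intervalIntegral.integral_of_le zero_le_one, this]
  simp

lemma isoGaussian_zero_bind_eq_withDensity :
    P.bind (fun y => isoGaussian y v) =
      volume.withDensity fun x => ENNReal.ofReal (gaussMix P v x) := by
  refine Measure.ext_of_lintegral _ fun f hf => ?_
  have hk : Measurable fun q : Vec d × Vec d => ENNReal.ofReal (gaussDensity v (q.1 - q.2)) * f q.1 :=
    ((measurable_gaussDensity v).comp (by fun_prop)).ennreal_ofReal.mul (by fun_prop)
  rw [Measure.lintegral_bind (measurable_isoGaussian hv.le).aemeasurable hf.aemeasurable,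
    lintegral_withDensity_eq_lintegral_mul _
      (continuous_gaussMix P hv).measurable.ennreal_ofReal hf]
  have h1 : ∀ y, ∫⁻ x, f x ∂(isoGaussian y v) =
      ∫⁻ x, ENNReal.ofReal (gaussDensity v (x - y)) * f x := by
    intro y
    rw [isoGaussian_eq_withDensity y hv, lintegral_withDensity_eq_lintegral_mul
      (f := fun x => ENNReal.ofReal (gaussDensity v (x - y))) _
      ((measurable_gaussDensity v).comp (measurable_id.sub_const y)).ennreal_ofReal hf]
    rfl
  simp_rw [h1]
  rw [lintegral_lintegral_swap (f := fun y x => ENNReal.ofReal (gaussDensity v (x - y)) * f x)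
    (hk.comp measurable_swap).aemeasurable]
  refine lintegral_congr fun x => ?_
  rw [lintegral_mul_const (f := fun y => ENNReal.ofReal (gaussDensity v (x - y))) _
      ((measurable_gaussDensity v).comp (measurable_id.const_sub x)).ennreal_ofReal,
    Pi.mul_apply, gaussMix, ofReal_integral_eq_lintegral_ofReal (integrable_gaussDensity_sub P hv x)
      (ae_of_all _ fun y => (gaussDensity_pos hv _).le)]

lemma lintegral_gaussMix : ∫⁻ x, ENNReal.ofReal (gaussMix P v x) = 1 := by
  have h := congrArg (fun μ : Measure (Vec d) => μ Set.univ) (isoGaussian_zero_bind_eq_withDensity P hv)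
  simp only [withDensity_apply _ MeasurableSet.univ, Measure.restrict_univ] at h
  rw [← h, Measure.bind_apply MeasurableSet.univ (measurable_isoGaussian hv.le).aemeasurable]
  simp

end Mix

/-! ### The forward process -/

lemma noiseVar_nonneg (α η : ℕ → ℝ) (t : ℕ) (hη : ∀ s < t, 0 < η s) : 0 ≤ noiseVar α η t := by
  induction t with
  | zero => simp [noiseVar]
  | succ t ih =>
    have := ih fun s hs => hη s (hs.trans t.lt_succ_self)
    have := hη t t.lt_succ_self
    simp only [noiseVar]; positivity

lemma noiseVar_pos (α η : ℕ → ℝ) (t : ℕ) (ht : 1 ≤ t) (hα : ∀ s < t, α s ≠ 0)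
    (hη : ∀ s < t, 0 < η s) : 0 < noiseVar α η t := by
  obtain ⟨t, rfl⟩ : ∃ k, t = k + 1 := ⟨t - 1, by omega⟩
  have h1 := noiseVar_nonneg α η t fun s hs => hη s (hs.trans t.lt_succ_self)
  have h2 := hη t t.lt_succ_self
  have h3 := hα t t.lt_succ_self
  simp only [noiseVar]; positivity

lemma measurable_isoGaussian_smul {d : ℕ} (a : ℝ) {v : ℝ} (hv : 0 ≤ v) :
    Measurable fun x : Vec d => isoGaussian (a • x) v :=
  (measurable_isoGaussian hv).comp (by fun_prop)

lemma forwardLaw_eq_bind {d : ℕ} (α η : ℕ → ℝ) (pdata : Measure (Vec d)) (t : ℕ)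
    (hη : ∀ s < t, 0 < η s) :
    forwardLaw α η pdata t = pdata.bind fun y => isoGaussian (scale α t • y) (noiseVar α η t) := by
  induction t with
  | zero => simp [forwardLaw, scale, noiseVar, isoGaussian_zero_var]
  | succ t ih =>
    have hη' : ∀ s < t, 0 < η s := fun s hs => hη s (hs.trans t.lt_succ_self)
    have h1 := noiseVar_nonneg α η t hη'
    have h2 := hη t t.lt_succ_self
    rw [forwardLaw, ih hη', Measure.bind_bind (measurable_isoGaussian_smul _ h1).aemeasurable
      (measurable_isoGaussian_smul _ (by positivity)).aemeasurable]
    congr 1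
    ext1 y
    rw [isoGaussian_bind _ h1 h2.le, smul_smul, scale, scale, Finset.prod_range_succ, mul_comm,
      noiseVar]

/-- Absorbing `ᾱ_t` into the mixing measure makes every `p_t` with positive variance a `gaussMix`,
the only form used in the one-step analysis. -/
lemma forwardLaw_eq_withDensity {d : ℕ} (α η : ℕ → ℝ) (pdata : Measure (Vec d))
    [IsProbabilityMeasure pdata] (t : ℕ) (hη : ∀ s < t, 0 < η s) (hv : 0 < noiseVar α η t) :
    forwardLaw α η pdata t = volume.withDensity fun x =>
      ENNReal.ofReal (gaussMix (pdata.map (scale α t • ·)) (noiseVar α η t) x) := by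
  have : IsProbabilityMeasure (pdata.map (scale α t • ·)) :=
    Measure.isProbabilityMeasure_map (by fun_prop)
  rw [← isoGaussian_zero_bind_eq_withDensity _ hv, forwardLaw_eq_bind α η pdata t hη]
  refine Measure.ext_of_lintegral _ fun f hf => ?_
  rw [Measure.lintegral_bind (measurable_isoGaussian_smul _ hv.le).aemeasurable hf.aemeasurable,
    Measure.lintegral_bind (measurable_isoGaussian hv.le).aemeasurable hf.aemeasurable,
    lintegral_map (f := fun m => ∫⁻ x, f x ∂(isoGaussian m (noiseVar α η t)))
      ((Measure.measurable_lintegral hf).comp (measurable_isoGaussian hv.le)) (by fun_prop)]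

lemma score_eq_gaussMixScore {d : ℕ} (α η : ℕ → ℝ) (pdata : Measure (Vec d)) (t : ℕ) :
    score α η pdata t = gaussMixScore (pdata.map (scale α t • ·)) (noiseVar α η t) := by
  have : ∀ x, forwardDensity α η pdata t x =
      gaussMix (pdata.map (scale α t • ·)) (noiseVar α η t) x := by
    intro x
    have hc : Continuous fun y => gaussDensity (noiseVar α η t) (x - y) :=
      (continuous_gaussDensity _).comp (by fun_prop)
    rw [gaussMix, integral_map (by fun_prop) hc.aestronglyMeasurable]
    rfl
  ext1 x
  unfold score gaussMixScore
  simp_rw [this]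

/-! ### First-order rejection sampling -/

lemma lintegral_poissonMeasure_ofReal_pow (r : ℝ≥0) {m : ℝ} (hm : 0 ≤ m) :
    ∫⁻ J, ENNReal.ofReal (m ^ J) ∂(poissonMeasure r) = ENNReal.ofReal (Real.exp (r * m - r)) := by
  rw [poissonMeasure, lintegral_sum_measure]
  have hrm : ((r * ⟨m, hm⟩ : ℝ≥0) : ℝ) = r * m := rfl
  have h := hasSum_one_poissonMeasure (r * ⟨m, hm⟩)
  rw [hrm] at h
  have h2 := h.mul_left (Real.exp (r * m - r))
  rw [mul_one] at h2
  rw [← h2.tsum_eq, ENNReal.ofReal_tsum_of_nonneg (fun n => by positivity) h2.summable]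
  congr 1
  ext1 n
  rw [lintegral_smul_measure, lintegral_dirac, smul_eq_mul, ← ENNReal.ofReal_mul (by positivity)]
  congr 1
  rw [show -(r : ℝ) = (r * m - r) + -(r * m) by ring, Real.exp_add, mul_pow]
  ring

/-- Given `J`, independence gives `μ^J` with `μ = (B + E W)/(2B)`; averaging over `J` gives
`exp(2B(μ - 1))`, and `2B(μ - 1) = E W - B`. -/
lemma forsAccept_eq {B : ℝ} (hB : 0 < B) (W : Measure ℝ) [IsProbabilityMeasure W]
    (hW : ∀ᵐ w ∂W, w ∈ Set.Icc (-B) B) :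
    forsAccept B W = ENNReal.ofReal (Real.exp (∫ w, w ∂W - B)) := by
  have hWi : Integrable (fun w : ℝ => w) W :=
    Integrable.of_bound (by fun_prop) B (hW.mono fun w hw => abs_le.2 hw)
  have hm : ∫ w, (B + w) / (2 * B) ∂W = (B + ∫ w, w ∂W) / (2 * B) := by
    rw [integral_div, integral_add (integrable_const _) hWi]; simp
  have hm0 : 0 ≤ ∫ w, (B + w) / (2 * B) ∂W :=
    integral_nonneg_of_ae (hW.mono fun w hw => div_nonneg (by linarith [hw.1]) (by linarith))
  have hin : ∀ J : ℕ, ∫⁻ w : Fin J → ℝ, ENNReal.ofReal (∏ j, (B + w j) / (2 * B))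
      ∂(Measure.pi fun _ : Fin J => W) = ENNReal.ofReal ((∫ w, (B + w) / (2 * B) ∂W) ^ J) := by
    intro J
    have hint : Integrable (fun w : Fin J → ℝ => ∏ j, (B + w j) / (2 * B))
        (Measure.pi fun _ : Fin J => W) :=
      Integrable.fintype_prod (f := fun _ w => (B + w) / (2 * B))
        fun _ => ((integrable_const B).add hWi).div_const _
    have hnn : 0 ≤ᵐ[Measure.pi fun _ : Fin J => W] fun w => ∏ j, (B + w j) / (2 * B) := by
      have : ∀ᵐ w ∂(Measure.pi fun _ : Fin J => W), ∀ j, w j ∈ Set.Icc (-B) B :=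
        ae_all_iff.2 fun j => (Measure.quasiMeasurePreserving_eval (fun _ : Fin J => W) j).ae hW
      refine this.mono fun w hw => Finset.prod_nonneg fun j _ => ?_
      exact div_nonneg (by linarith [(hw j).1]) (by linarith)
    rw [← ofReal_integral_eq_lintegral_ofReal hint hnn,
      integral_fintype_prod_eq_pow (fun w => (B + w) / (2 * B)), Fintype.card_fin]
  unfold forsAccept
  simp_rw [hin]
  rw [lintegral_poissonMeasure_ofReal_pow _ hm0, hm, Real.coe_toNNReal _ (by linarith)]
  congr 2
  field_simp
  ring

/-- A geometric series in the miss probability, whose complement is the success probability of one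
iteration. -/
lemma forsLaw_eq_smul {d : ℕ} (B : ℝ) (q : Measure (Vec d)) [IsProbabilityMeasure q]
    (W : Vec d → Measure ℝ) (hm : Measurable fun x => forsAccept B (W x))
    (h1 : ∀ x, forsAccept B (W x) ≤ 1) :
    forsLaw B q W = (∫⁻ x, forsAccept B (W x) ∂q)⁻¹ • forsHit B q W := by
  have hle : ∫⁻ x, forsAccept B (W x) ∂q ≤ 1 := by
    calc _ ≤ ∫⁻ _, 1 ∂q := lintegral_mono h1
      _ = 1 := by simp
  have hmiss : forsMiss B q W = 1 - ∫⁻ x, forsAccept B (W x) ∂q := by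
    rw [forsMiss, lintegral_sub hm (ne_top_of_le_ne_top ENNReal.one_ne_top hle) (ae_of_all _ h1)]
    simp
  ext s hs
  rw [forsLaw, Measure.sum_apply _ hs]
  simp only [Measure.smul_apply, smul_eq_mul]
  rw [ENNReal.tsum_mul_right, ENNReal.tsum_geometric, hmiss,
    ENNReal.sub_sub_cancel ENNReal.one_ne_top hle]

/-! ### The straight-line estimators -/

lemma abs_clip_le {B : ℝ} (hB : 0 ≤ B) (a : ℝ) : |clip B a| ≤ B :=
  abs_le.2 ⟨le_max_left _ _, max_le (by linarith) (min_le_left _ _)⟩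

lemma measurable_clip (B : ℝ) : Measurable (clip B) := by unfold clip; fun_prop

/-- The mean of the straight-line estimator. -/
noncomputable def lineMean {d : ℕ} (B : ℝ) (s : Vec d → Vec d) (xbar x : Vec d) : ℝ :=
  ∫ r in Set.Icc (0 : ℝ) 1, clip B (inner ℝ (x - xbar) (s (r • x + (1 - r) • xbar)))

section Line

variable {d : ℕ} {B : ℝ} {s : Vec d → Vec d}

instance : IsProbabilityMeasure (volume.restrict (Set.Icc (0 : ℝ) 1)) := ⟨by simp⟩

lemma measurable_clip_line (hs : Measurable s) :
    Measurable fun q : (Vec d × Vec d) × ℝ =>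
      clip B (inner ℝ (q.1.2 - q.1.1) (s (q.2 • q.1.2 + (1 - q.2) • q.1.1))) := by
  have := measurable_clip B
  fun_prop

lemma measurable_clip_line_right (hs : Measurable s) (xbar x : Vec d) :
    Measurable fun r : ℝ => clip B (inner ℝ (x - xbar) (s (r • x + (1 - r) • xbar))) := by
  have := measurable_clip B
  fun_prop

lemma integrable_clip_line (hB : 0 ≤ B) (hs : Measurable s) (xbar x : Vec d) :
    Integrable (fun r : ℝ => clip B (inner ℝ (x - xbar) (s (r • x + (1 - r) • xbar))))
      (volume.restrict (Set.Icc (0 : ℝ) 1)) :=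
  Integrable.of_bound (measurable_clip_line_right hs xbar x).aestronglyMeasurable B
    (ae_of_all _ fun _ => abs_clip_le hB _)

lemma abs_lineMean_le (hB : 0 ≤ B) (xbar x : Vec d) : |lineMean B s xbar x| ≤ B := by
  have := norm_integral_le_of_norm_le_const (μ := volume.restrict (Set.Icc (0 : ℝ) 1)) (C := B)
    (f := fun r => clip B (inner ℝ (x - xbar) (s (r • x + (1 - r) • xbar))))
    (ae_of_all _ fun _ => abs_clip_le hB _)
  rwa [probReal_univ, mul_one] at this

lemma measurable_lineMean (hs : Measurable s) :
    Measurable fun q : Vec d × Vec d => lineMean B s q.1 q.2 :=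
  ((measurable_clip_line hs).stronglyMeasurable.integral_prod_right'
    (ν := volume.restrict (Set.Icc (0 : ℝ) 1))).measurable

lemma measurable_lineMean_comp {Ω : Type*} [MeasurableSpace Ω] (hs : Measurable s)
    {f g : Ω → Vec d} (hf : Measurable f) (hg : Measurable g) :
    Measurable fun ω => lineMean B s (f ω) (g ω) := by
  have h := (measurable_lineMean (B := B) hs).comp (hf.prodMk hg)
  simpa only [Function.comp_def] using h

lemma forsAccept_lineEstimator (hB : 0 < B) (hs : Measurable s) (xbar x : Vec d) :
    forsAccept B (lineEstimator B s xbar x) =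
      ENNReal.ofReal (Real.exp (lineMean B s xbar x - B)) := by
  have hm := measurable_clip_line_right (B := B) hs xbar x
  have : IsProbabilityMeasure (lineEstimator B s xbar x) :=
    Measure.isProbabilityMeasure_map hm.aemeasurable
  rw [forsAccept_eq hB]
  · rw [lineEstimator, integral_map hm.aemeasurable (by fun_prop)]
    rfl
  · refine (ae_map_iff hm.aemeasurable (p := (· ∈ Set.Icc (-B) B)) measurableSet_Icc).2 ?_
    exact ae_of_all _ fun r => abs_le.1 (abs_clip_le hB.le _)

end Line

/-- One step of the sampler: first-order rejection sampling with proposal `N(a⁻¹ x', h I)` and the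
straight-line estimators. -/
noncomputable def samplerStep {d : ℕ} (B a h : ℝ) (s : Vec d → Vec d) (x' : Vec d) :
    Measure (Vec d) :=
  forsLaw B (isoGaussian (a⁻¹ • x') h) (lineEstimator B s (a⁻¹ • x'))

/-- The probability that an iteration of the rejection sampler with base point `y` succeeds. -/
noncomputable def hitProb {d : ℕ} (B h : ℝ) (s : Vec d → Vec d) (y : Vec d) : ℝ≥0∞ :=
  ∫⁻ u, ENNReal.ofReal (Real.exp (lineMean B s y (y + u) - B)) ∂(isoGaussian 0 h)

/-! ### One step of the sampler as a Markov kernel. -/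

section Step

variable {d : ℕ} {B h : ℝ} {s : Vec d → Vec d} (hB : 0 < B) (hh : 0 ≤ h) (hs : Measurable s)
include hB

lemma hitProb_le_one (y : Vec d) : hitProb B h s y ≤ 1 := by
  calc hitProb B h s y ≤ ∫⁻ _, 1 ∂(isoGaussian (0 : Vec d) h) := by
        refine lintegral_mono fun u => ?_
        rw [ENNReal.ofReal_le_one, Real.exp_le_one_iff]
        linarith [(abs_le.1 (abs_lineMean_le (s := s) hB.le y (y + u))).2]
    _ = 1 := by simp

/-- Clipping keeps the acceptance probability at least `e^{-2B}` everywhere. -/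
lemma hitProb_ne_zero (y : Vec d) : hitProb B h s y ≠ 0 := by
  have : ENNReal.ofReal (Real.exp (-B - B)) ≤ hitProb B h s y := by
    calc _ = ∫⁻ _, ENNReal.ofReal (Real.exp (-B - B)) ∂(isoGaussian (0 : Vec d) h) := by simp
      _ ≤ _ := by
        refine lintegral_mono fun u => ENNReal.ofReal_le_ofReal (Real.exp_le_exp.2 ?_)
        linarith [(abs_le.1 (abs_lineMean_le (s := s) hB.le y (y + u))).1]
  exact (lt_of_lt_of_le (ENNReal.ofReal_pos.2 (Real.exp_pos _)) this).ne'

omit hB in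
include hs in
lemma measurable_hitDensity :
    Measurable fun q : Vec d × Vec d =>
      ENNReal.ofReal (Real.exp (lineMean B s q.1 (q.1 + q.2) - B)) := by
  have := measurable_lineMean_comp (B := B) hs (f := fun q : Vec d × Vec d => q.1)
    (g := fun q => q.1 + q.2) (by fun_prop) (by fun_prop)
  exact ((this.sub_const B).exp).ennreal_ofReal

omit hB in
include hs in
lemma measurable_hitProb : Measurable (hitProb B h s) :=
  (measurable_hitDensity hs).lintegral_prod_right'

include hh hs

lemma lintegral_samplerStep (a : ℝ) (x' : Vec d) {f : Vec d → ℝ≥0∞} (hf : Measurable f) :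
    ∫⁻ x, f x ∂(samplerStep B a h s x') = (hitProb B h s (a⁻¹ • x'))⁻¹ *
      ∫⁻ u, ENNReal.ofReal (Real.exp (lineMean B s (a⁻¹ • x') (a⁻¹ • x' + u) - B)) *
        f (a⁻¹ • x' + u) ∂(isoGaussian 0 h) := by
  set y := a⁻¹ • x'
  have hacc := fun x => forsAccept_lineEstimator hB hs y x
  have hm : Measurable fun x => forsAccept B (lineEstimator B s y x) := by
    simp_rw [hacc]
    exact (((measurable_lineMean hs).comp (measurable_prodMk_left (x := y))).sub_const
      B).exp.ennreal_ofReal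
  rw [samplerStep, forsLaw_eq_smul B _ _ hm, lintegral_smul_measure, forsHit,
    lintegral_withDensity_eq_lintegral_mul _ hm hf, isoGaussian_eq_map_add y hh,
    lintegral_map hm (by fun_prop), lintegral_map (hm.mul hf) (by fun_prop)]
  · simp only [Pi.mul_apply, hacc, smul_eq_mul, hitProb]
  · intro x
    rw [hacc, ENNReal.ofReal_le_one, Real.exp_le_one_iff]
    linarith [(abs_le.1 (abs_lineMean_le (s := s) hB.le y x)).2]

/-- The total mass is the probability of termination, so this is almost sure termination of one
step. -/
lemma isProbabilityMeasure_samplerStep (a : ℝ) (x' : Vec d) :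
    IsProbabilityMeasure (samplerStep B a h s x') := by
  refine ⟨?_⟩
  rw [← lintegral_one, lintegral_samplerStep hB hh hs a x' measurable_const]
  simp only [mul_one]
  exact ENNReal.inv_mul_cancel (hitProb_ne_zero hB _)
    (ne_top_of_le_ne_top ENNReal.one_ne_top (hitProb_le_one hB _))

lemma measurable_samplerStep (a : ℝ) : Measurable (samplerStep B a h s) := by
  refine Measure.measurable_of_measurable_coe _ fun A hA => ?_
  simp_rw [← lintegral_indicator_one hA, lintegral_samplerStep hB hh hs a _
    (measurable_one.indicator hA)]
  have h1 : Measurable fun x' : Vec d => a⁻¹ • x' := by fun_prop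
  refine (((measurable_hitProb hs).comp h1).inv).mul ?_
  have h2 : Measurable fun y : Vec d => ∫⁻ u,
      ENNReal.ofReal (Real.exp (lineMean B s y (y + u) - B)) * A.indicator 1 (y + u)
        ∂(isoGaussian 0 h) :=
    Measurable.lintegral_prod_right' (f := fun q : Vec d × Vec d =>
      ENNReal.ofReal (Real.exp (lineMean B s q.1 (q.1 + q.2) - B)) * A.indicator 1 (q.1 + q.2))
      ((measurable_hitDensity hs).mul ((measurable_one.indicator hA).comp (by fun_prop)))
  exact h2.comp h1

end Step

/-! ### The function `y ↦ y + e^{-y} - 1` -/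

/-- `y + e^{-y} - 1`, which is `klFun` after the change of variables `x = e^y` and
division by `x`. -/
noncomputable def expDefect (y : ℝ) : ℝ := y + Real.exp (-y) - 1

lemma continuous_expDefect : Continuous expDefect := by unfold expDefect; fun_prop

lemma expDefect_nonneg (y : ℝ) : 0 ≤ expDefect y := by
  have := Real.add_one_le_exp (-y)
  unfold expDefect; linarith

lemma convexOn_expDefect : ConvexOn ℝ Set.univ expDefect := by
  have h1 : ConvexOn ℝ Set.univ fun y : ℝ => Real.exp (-y) :=
    convexOn_exp.comp_linearMap (-LinearMap.id)
  exact ConvexOn.sub (ConvexOn.add (convexOn_id convex_univ) h1)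
    (concaveOn_const 1 convex_univ)

lemma expDefect_le_exp_abs (y : ℝ) : expDefect y ≤ Real.exp |y| := by
  unfold expDefect
  rcases le_total 0 y with hy | hy
  · have := Real.exp_le_one_iff.2 (neg_nonpos.2 hy)
    have := Real.add_one_le_exp y
    rw [abs_of_nonneg hy]; linarith
  · rw [abs_of_nonpos hy]; linarith

lemma expDefect_le_sq_mul_exp_abs (y : ℝ) : expDefect y ≤ y ^ 2 * Real.exp |y| := by
  have h1 : ∀ x : ℝ, Real.exp x - 1 ≤ x * Real.exp x := by
    intro x
    have := mul_le_mul_of_nonneg_right (Real.add_one_le_exp (-x)) (Real.exp_pos x).le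
    rw [← Real.exp_add, neg_add_cancel, Real.exp_zero] at this
    linarith
  have h2 : expDefect y ≤ (-y) * (Real.exp (-y) - 1) := by
    have := h1 (-y); unfold expDefect; linarith
  refine h2.trans ?_
  rcases le_total 0 y with hy | hy
  · rw [abs_of_nonneg hy]
    have h3 := Real.add_one_le_exp (-y)
    have h4 := Real.one_le_exp hy
    nlinarith [mul_nonneg hy (sub_nonneg.2 h3), mul_nonneg (sq_nonneg y) (sub_nonneg.2 h4)]
  · rw [abs_of_nonpos hy]
    have h3 := h1 (-y)
    nlinarith [mul_nonneg (neg_nonneg.2 hy) (sub_nonneg.2 h3)]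

/-- Projection onto an interval does not increase the distance to a point of that interval. -/
lemma abs_sub_clip_le {B a b : ℝ} (ha : |a| ≤ B) : |a - clip B b| ≤ |a - b| := by
  obtain ⟨h1, h2⟩ := abs_le.1 ha
  rw [clip]
  rcases le_total B b with hb | hb
  · rw [min_eq_left hb, max_eq_right (by linarith), abs_of_nonpos (by linarith),
      abs_of_nonpos (by linarith)]
    linarith
  · rw [min_eq_right hb]
    rcases le_total (-B) b with hb' | hb'
    · rw [max_eq_right hb']
    · rw [max_eq_left hb', abs_of_nonneg (by linarith), abs_of_nonneg (by linarith)]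
      linarith

/-- The key pointwise estimate: off the event that `|a|` or the ratio `ρ` is large, the clipped
error is controlled by the squared error. -/
lemma mul_expDefect_sub_clip_le {B a b ρ : ℝ} (hB : 0 < B) (hρ : 0 < ρ) {m : ℕ} (hm : 2 ≤ m) :
    ρ * expDefect (a - clip B b) ≤ Real.exp (3 * B) * ((a - b) ^ 2 +
      Real.exp (-(m * B)) * (ρ ^ m + Real.exp (m * a) + Real.exp (-(m * a)))) := by
  have hclip := abs_clip_le hB.le b
  have htail : 0 ≤ Real.exp (-(m * B)) * (ρ ^ m + Real.exp (m * a) + Real.exp (-(m * a))) := by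
    positivity
  -- On the good event the clipped error is at most `2B` in modulus, so the defect is quadratic up
  -- to `e^{2B}`, and `ρ` costs another `e^B`. Off it, the maximum `M` of `ρ` and `e^{|a|}` is at
  -- least `e^B`.
  by_cases hgood : |a| ≤ B ∧ ρ ≤ Real.exp B
  · obtain ⟨ha, hρB⟩ := hgood
    have h1 : |a - clip B b| ≤ 2 * B := (abs_sub _ _).trans (by linarith)
    have h2 : (a - clip B b) ^ 2 ≤ (a - b) ^ 2 := sq_le_sq.2 (abs_sub_clip_le ha)
    calc ρ * expDefect (a - clip B b)
        ≤ Real.exp B * ((a - b) ^ 2 * Real.exp (2 * B)) := by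
          refine mul_le_mul hρB ((expDefect_le_sq_mul_exp_abs _).trans ?_) (expDefect_nonneg _)
            (Real.exp_pos _).le
          gcongr
      _ = Real.exp (3 * B) * (a - b) ^ 2 := by
          rw [show 3 * B = B + 2 * B by ring, Real.exp_add]; ring
      _ ≤ _ := by gcongr; linarith
  · set M := max ρ (Real.exp |a|) with hM
    have hMρ : ρ ≤ M := le_max_left _ _
    have hMa : Real.exp |a| ≤ M := le_max_right _ _
    have hMB : Real.exp B ≤ M := by
      rw [not_and_or, not_le, not_le] at hgood
      rcases hgood with h | h
      · exact (Real.exp_le_exp.2 h.le).trans hMa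
      · exact h.le.trans hMρ
    have hM0 : 0 < M := hρ.trans_le hMρ
    have h1 : expDefect (a - clip B b) ≤ Real.exp B * Real.exp |a| := by
      refine (expDefect_le_exp_abs _).trans ?_
      rw [← Real.exp_add]
      exact Real.exp_le_exp.2 ((abs_sub _ _).trans (by linarith))
    have h2 : M ^ m ≤ ρ ^ m + Real.exp (m * a) + Real.exp (-(m * a)) := by
      have e1 : Real.exp |a| ^ m ≤ Real.exp (m * a) + Real.exp (-(m * a)) := by
        rw [← Real.exp_nat_mul]
        rcases abs_cases a with h | h <;> rw [h.1]
        · linarith [Real.exp_pos (-(m * a))]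
        · rw [mul_neg]; linarith [Real.exp_pos (m * a)]
      rcases max_cases ρ (Real.exp |a|) with h | h <;> rw [hM, h.1]
      · linarith [Real.exp_pos (m * a), Real.exp_pos (-(m * a))]
      · linarith [pow_pos hρ m]
    -- A Markov-type exchange: `M ≥ e^B` lets `M²` be replaced by `M^m` with gain `e^{-(m-2)B}`.
    have h3 : M ^ 2 ≤ Real.exp (2 * B) * Real.exp (-(m * B)) * M ^ m := by
      obtain ⟨k, rfl⟩ : ∃ k, m = k + 2 := ⟨m - 2, by omega⟩
      have e1 : Real.exp B ^ k ≤ M ^ k := pow_le_pow_left₀ (Real.exp_pos _).le hMB k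
      have e2 : Real.exp (2 * B) * Real.exp (-((k + 2 : ℕ) * B)) * Real.exp B ^ k = 1 := by
        rw [← Real.exp_nat_mul, ← Real.exp_add, ← Real.exp_add, Real.exp_eq_one_iff]
        push_cast; ring
      calc M ^ 2 = (Real.exp (2 * B) * Real.exp (-((k + 2 : ℕ) * B)) * Real.exp B ^ k) * M ^ 2 := by
            rw [e2, one_mul]
        _ ≤ (Real.exp (2 * B) * Real.exp (-((k + 2 : ℕ) * B)) * M ^ k) * M ^ 2 := by gcongr
        _ = _ := by ring
    calc ρ * expDefect (a - clip B b) ≤ M * (Real.exp B * M) := by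
          refine mul_le_mul hMρ (h1.trans ?_) (expDefect_nonneg _) hM0.le
          gcongr
      _ = Real.exp B * M ^ 2 := by ring
      _ ≤ Real.exp B * (Real.exp (2 * B) * Real.exp (-(m * B)) *
          (ρ ^ m + Real.exp (m * a) + Real.exp (-(m * a)))) := by
          gcongr
          exact h3.trans (by gcongr)
      _ = Real.exp (3 * B) * (Real.exp (-(m * B)) *
          (ρ ^ m + Real.exp (m * a) + Real.exp (-(m * a)))) := by
          rw [show 3 * B = B + 2 * B by ring, Real.exp_add]; ring
      _ ≤ _ := by
          gcongr
          linarith [sq_nonneg (a - b)]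

/-! ### Relative entropy -/

section KL

/-- The likelihood ratio is `e^Δ`, and `e^{-Δ} klFun(e^Δ) = Δ + e^{-Δ} - 1`. The masses may differ,
since `klFun` carries the mass correction; this permits unnormalised references. -/
lemma klDiv_withDensity_exp {Ω : Type*} [MeasurableSpace Ω] (β : Measure Ω) {f Δ : Ω → ℝ}
    (hf : Measurable f) (hΔ : Measurable Δ) (hpos : ∀ x, 0 < f x)
    (hfin : ∫⁻ x, ENNReal.ofReal (f x) ∂β ≠ ∞)
    (hfin' : ∫⁻ x, ENNReal.ofReal (f x * Real.exp (-Δ x)) ∂β ≠ ∞) :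
    klDiv (β.withDensity fun x => ENNReal.ofReal (f x))
      (β.withDensity fun x => ENNReal.ofReal (f x * Real.exp (-Δ x))) =
      ∫⁻ x, ENNReal.ofReal (f x * expDefect (Δ x)) ∂β := by
  have hg : Measurable fun x => ENNReal.ofReal (f x * Real.exp (-Δ x)) :=
    (hf.mul hΔ.neg.exp).ennreal_ofReal
  have hr : Measurable fun x => ENNReal.ofReal (Real.exp (Δ x)) := hΔ.exp.ennreal_ofReal
  have : IsFiniteMeasure (β.withDensity fun x => ENNReal.ofReal (f x)) :=
    isFiniteMeasure_withDensity hfin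
  have : IsFiniteMeasure (β.withDensity fun x => ENNReal.ofReal (f x * Real.exp (-Δ x))) :=
    isFiniteMeasure_withDensity hfin'
  have heq : (β.withDensity fun x => ENNReal.ofReal (f x)) =
      (β.withDensity fun x => ENNReal.ofReal (f x * Real.exp (-Δ x))).withDensity
        fun x => ENNReal.ofReal (Real.exp (Δ x)) := by
    rw [← withDensity_mul _ hg hr]
    congr 1
    ext1 x
    rw [Pi.mul_apply, ← ENNReal.ofReal_mul (mul_pos (hpos x) (Real.exp_pos _)).le, mul_assoc,
      ← Real.exp_add, neg_add_cancel, Real.exp_zero, mul_one]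
  have hac : (β.withDensity fun x => ENNReal.ofReal (f x)) ≪
      (β.withDensity fun x => ENNReal.ofReal (f x * Real.exp (-Δ x))) := by
    rw [heq]; exact withDensity_absolutelyContinuous _ _
  rw [klDiv_eq_lintegral_klFun_of_ac hac]
  have hrn := Measure.rnDeriv_withDensity
    (β.withDensity fun x => ENNReal.ofReal (f x * Real.exp (-Δ x))) hr
  rw [← heq] at hrn
  have h1 : ∫⁻ x, ENNReal.ofReal (klFun ((β.withDensity fun x => ENNReal.ofReal (f x)).rnDeriv
      (β.withDensity fun x => ENNReal.ofReal (f x * Real.exp (-Δ x))) x).toReal)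
      ∂(β.withDensity fun x => ENNReal.ofReal (f x * Real.exp (-Δ x))) =
      ∫⁻ x, ENNReal.ofReal (klFun (Real.exp (Δ x)))
        ∂(β.withDensity fun x => ENNReal.ofReal (f x * Real.exp (-Δ x))) :=
    lintegral_congr_ae (hrn.mono fun x hx => by
      simp only [hx, ENNReal.toReal_ofReal (Real.exp_pos _).le])
  rw [h1, lintegral_withDensity_eq_lintegral_mul _ hg (by fun_prop)]
  refine lintegral_congr fun x => ?_
  rw [Pi.mul_apply, ← ENNReal.ofReal_mul (mul_pos (hpos x) (Real.exp_pos _)).le, klFun_apply,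
    Real.log_exp, expDefect, Real.exp_neg]
  congr 1
  field_simp

/-- Comparison of a reversed Markov chain with an arbitrary one: `n` may be any finite measure. -/
lemma klDiv_bind_le {X Y : Type*} [MeasurableSpace X] [MeasurableSpace Y] [StandardBorelSpace X]
    [Nonempty X] (μ : Measure X) [IsFiniteMeasure μ] (κ : Kernel X Y) [IsMarkovKernel κ]
    (ν n : Measure Y) [IsFiniteMeasure ν] [IsFiniteMeasure n] (Q : Kernel Y X) [IsMarkovKernel Q] :
    klDiv μ (ν.bind Q) ≤
      klDiv (μ.bind κ) ν + klDiv ((μ ⊗ₘ κ).map Prod.swap) (n ⊗ₘ Q) := by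
  have h1 : klDiv μ (ν.bind Q) ≤ klDiv ((μ.bind κ) ⊗ₘ (κ†μ)) (ν ⊗ₘ Q) := by
    calc klDiv μ (ν.bind Q) = klDiv (((μ.bind κ) ⊗ₘ (κ†μ)).map Prod.snd) ((ν ⊗ₘ Q).map Prod.snd) := by
          rw [← Measure.snd, ← Measure.snd, Measure.snd_compProd, Measure.snd_compProd,
            posterior_comp_self]
      _ ≤ _ := klDiv_map_le _ _ measurable_snd
  refine h1.trans ?_
  -- The conditional term of the chain rule does not see the first marginal of the second measure.
  -- So `ν` can be exchanged for `n`, at the price of the nonnegative term `klDiv (μ.bind κ) n`.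
  rw [klDiv_compProd_eq_add, ← compProd_posterior_eq_map_swap, klDiv_compProd_eq_add _ n]
  gcongr
  exact le_add_self

end KL

/-! ### The error of one step -/

/-- The log-ratio between the true transition and the (unnormalised) sampler transition, as a
function of the end point `x` and the increment `u = x - x̄`. -/
noncomputable def stepLogRatio {d : ℕ} (B v : ℝ) (P : Measure (Vec d)) (s : Vec d → Vec d)
    (x u : Vec d) : ℝ :=
  Real.log (gaussMix P v x) - Real.log (gaussMix P v (x - u)) - lineMean B s (x - u) x

section

variable {d : ℕ} {B v : ℝ} (P : Measure (Vec d)) [IsProbabilityMeasure P] {s : Vec d → Vec d}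
  (hB : 0 < B) (hv : 0 < v) (hs : Measurable s)
include hB hv hs

omit hB in
lemma measurable_stepLogRatio :
    Measurable fun q : Vec d × Vec d => stepLogRatio B v P s q.1 q.2 := by
  have hp := (continuous_gaussMix P hv).measurable
  have h1 := measurable_lineMean_comp (B := B) hs (f := fun q : Vec d × Vec d => q.1 - q.2)
    (g := fun q => q.1) (by fun_prop) (by fun_prop)
  exact ((hp.comp measurable_fst).log.sub (hp.comp (measurable_fst.sub measurable_snd)).log).sub h1

omit hB in
lemma measurable_expDefect_local :
    Measurable fun q : Vec d × Vec d =>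
      expDefect (inner ℝ q.2 (gaussMixScore P v q.1) - clip B (inner ℝ q.2 (s q.1))) := by
  have h1 := (continuous_gaussMixScore P hv).measurable
  have h2 := measurable_clip B
  have h3 := continuous_expDefect.measurable
  fun_prop

/-- Jensen's inequality along the segment from `x - u` to `x`. -/
lemma expDefect_stepLogRatio_le (x u : Vec d) :
    ENNReal.ofReal (expDefect (stepLogRatio B v P s x u)) ≤
      ∫⁻ r in Set.Icc (0 : ℝ) 1, ENNReal.ofReal (expDefect
        (inner ℝ u (gaussMixScore P v (x - (1 - r) • u)) -
          clip B (inner ℝ u (s (x - (1 - r) • u))))) := by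
  have hc := continuous_gaussMixScore P hv
  set F := fun r : ℝ => inner ℝ u (gaussMixScore P v (x - (1 - r) • u)) with hF
  set G := fun r : ℝ => clip B (inner ℝ u (s (x - (1 - r) • u))) with hG
  have hFc : Continuous F := by fun_prop
  have hFi : Integrable F (volume.restrict (Set.Icc (0 : ℝ) 1)) :=
    hFc.continuousOn.integrableOn_compact isCompact_Icc
  have hline : ∀ r : ℝ, r • x + (1 - r) • (x - u) = x - (1 - r) • u := fun r => by module
  have hGi : Integrable G (volume.restrict (Set.Icc (0 : ℝ) 1)) := by
    have := integrable_clip_line (s := s) hB.le hs (x - u) x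
    simpa only [sub_sub_cancel, hline] using this
  have hmean : lineMean B s (x - u) x = ∫ r in Set.Icc (0 : ℝ) 1, G r := by
    simp only [lineMean, sub_sub_cancel, hline, hG]
  have heq : stepLogRatio B v P s x u = ∫ r in Set.Icc (0 : ℝ) 1, (F r - G r) := by
    rw [integral_sub hFi hGi, ← hmean, ← log_gaussMix_sub_eq_integral P hv x u, stepLogRatio]
  obtain ⟨M, hM⟩ := isCompact_Icc.exists_bound_of_continuousOn (s := Set.Icc (0 : ℝ) 1)
    hFc.continuousOn
  have hint : Integrable (fun r => expDefect (F r - G r)) (volume.restrict (Set.Icc (0 : ℝ) 1)) := by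
    refine Integrable.of_bound (continuous_expDefect.measurable.comp_aemeasurable
      (hFi.sub hGi).aemeasurable).aestronglyMeasurable (Real.exp (M + B)) ?_
    refine (ae_restrict_mem measurableSet_Icc).mono fun r hr => ?_
    rw [Real.norm_of_nonneg (expDefect_nonneg _)]
    refine (expDefect_le_exp_abs _).trans (Real.exp_le_exp.2 ((abs_sub _ _).trans ?_))
    exact add_le_add (hM r hr) (abs_clip_le hB.le _)
  rw [heq, ← ofReal_integral_eq_lintegral_ofReal hint (ae_of_all _ fun _ => expDefect_nonneg _)]
  exact ENNReal.ofReal_le_ofReal (convexOn_expDefect.map_integral_le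
    continuous_expDefect.continuousOn isClosed_univ (ae_of_all _ fun _ => Set.mem_univ _)
    (hFi.sub hGi) hint)

omit hs in
/-- The pointwise estimate at the intermediate point `z`, multiplied by the density. -/
lemma gaussMix_mul_expDefect_le {m : ℕ} (hm : 2 ≤ m) {τ : ℝ} (hτ0 : 0 ≤ τ) (hτ1 : τ ≤ 1)
    (z u : Vec d) :
    gaussMix P v (z + τ • u) *
        expDefect (inner ℝ u (gaussMixScore P v z) - clip B (inner ℝ u (s z))) ≤
      Real.exp (3 * B) * (gaussMix P v z * inner ℝ u (gaussMixScore P v z - s z) ^ 2 +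
        Real.exp (-(m * B)) * Real.exp ((m : ℝ) ^ 2 / (2 * v) * ‖u‖ ^ 2) *
          (gaussMix P v (z + ((m : ℝ) * τ) • u) + gaussMix P v (z + (m : ℝ) • u) +
            gaussMix P v (z + (-(m : ℝ)) • u))) := by
  have hp := gaussMix_pos P hv
  set a := inner ℝ u (gaussMixScore P v z) with ha
  set b := inner ℝ u (s z) with hb
  set E := Real.exp ((m : ℝ) ^ 2 / (2 * v) * ‖u‖ ^ 2) with hE
  set ρ := gaussMix P v (z + τ • u) / gaussMix P v z with hρ
  have hρ0 : 0 < ρ := div_pos (hp _) (hp _)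
  have h1 := mul_le_mul_of_nonneg_left
    (mul_expDefect_sub_clip_le (a := a) (b := b) hB hρ0 hm) (hp z).le
  have e1 : gaussMix P v z * ρ = gaussMix P v (z + τ • u) := mul_div_cancel₀ _ (hp z).ne'
  rw [← mul_assoc, e1] at h1
  have h2 : gaussMix P v z * ρ ^ m ≤ E * gaussMix P v (z + ((m : ℝ) * τ) • u) := by
    have := gaussMix_mul_ratio_pow_le P hv z (τ • u) m (by omega)
    rw [smul_smul, norm_smul, Real.norm_of_nonneg hτ0] at this
    refine this.trans (mul_le_mul_of_nonneg_right (Real.exp_le_exp.2 ?_) (hp _).le)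
    rw [div_mul_eq_mul_div]
    gcongr
    exact mul_le_of_le_one_left (norm_nonneg _) hτ1
  have h3 : gaussMix P v z * Real.exp (m * a) ≤ E * gaussMix P v (z + (m : ℝ) • u) := by
    have := gaussMix_mul_exp_inner_score_le P hv z ((m : ℝ) • u)
    rw [real_inner_smul_left, norm_smul, Real.norm_natCast, mul_pow, mul_div_right_comm] at this
    exact this
  have h4 : gaussMix P v z * Real.exp (-(m * a)) ≤ E * gaussMix P v (z + (-(m : ℝ)) • u) := by
    have := gaussMix_mul_exp_inner_score_le P hv z ((-(m : ℝ)) • u)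
    rw [real_inner_smul_left, norm_smul, norm_neg, Real.norm_natCast, mul_pow,
      mul_div_right_comm, neg_mul] at this
    exact this
  rw [inner_sub_right]
  refine h1.trans ?_
  rw [mul_left_comm]
  refine mul_le_mul_of_nonneg_left ?_ (Real.exp_pos _).le
  rw [mul_add]
  refine add_le_add le_rfl ?_
  calc _ = Real.exp (-(m * B)) * (gaussMix P v z * ρ ^ m + gaussMix P v z * Real.exp (m * a) +
        gaussMix P v z * Real.exp (-(m * a))) := by ring
    _ ≤ Real.exp (-(m * B)) * (E * gaussMix P v (z + ((m : ℝ) * τ) • u) +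
        E * gaussMix P v (z + (m : ℝ) • u) + E * gaussMix P v (z + (-(m : ℝ)) • u)) := by gcongr
    _ = _ := by ring

/-- Integrating over `z` first, each of the three translated densities has mass one, which leaves
three copies of the Gaussian exponential moment, each at most `δ`. In the main term the average over
`u` is taken first, using isotropy. Here `τ` is `1 - r` for the position `r` on the segment. -/
lemma lintegral_shifted_expDefect_le {h δ : ℝ} (hh : 0 < h) {m : ℕ} (hm : 2 ≤ m)
    (hmv : (m : ℝ) ^ 2 * h / v ≤ 1 / 2)
    (hδ : Real.exp (-(m * B)) * Real.exp ((m : ℝ) ^ 2 * h / v * d) ≤ δ)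
    {τ : ℝ} (hτ0 : 0 ≤ τ) (hτ1 : τ ≤ 1) :
    ∫⁻ u, (∫⁻ z, ENNReal.ofReal (gaussMix P v (z + τ • u) *
        expDefect (inner ℝ u (gaussMixScore P v z) - clip B (inner ℝ u (s z)))))
        ∂(isoGaussian (0 : Vec d) h) ≤
      ENNReal.ofReal (Real.exp (3 * B)) *
        (ENNReal.ofReal h * (∫⁻ z, ENNReal.ofReal (gaussMix P v z) *
          ENNReal.ofReal (‖s z - gaussMixScore P v z‖ ^ 2)) + 3 * ENNReal.ofReal δ) := by
  have hp := gaussMix_pos P hv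
  have hpm := (continuous_gaussMix P hv).measurable
  have hSm := (continuous_gaussMixScore P hv).measurable
  set γ := isoGaussian (0 : Vec d) h
  set E : Vec d → ℝ≥0∞ := fun u =>
    ENNReal.ofReal (Real.exp (-(m * B)) * Real.exp ((m : ℝ) ^ 2 / (2 * v) * ‖u‖ ^ 2)) with hE
  have hEm : Measurable E := by fun_prop
  have hpt : ∀ u z, ENNReal.ofReal (gaussMix P v (z + τ • u) *
      expDefect (inner ℝ u (gaussMixScore P v z) - clip B (inner ℝ u (s z)))) ≤
      ENNReal.ofReal (Real.exp (3 * B)) * (ENNReal.ofReal (gaussMix P v z) *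
        ENNReal.ofReal (inner ℝ u (gaussMixScore P v z - s z) ^ 2) +
        E u * (ENNReal.ofReal (gaussMix P v (z + ((m : ℝ) * τ) • u)) +
          ENNReal.ofReal (gaussMix P v (z + (m : ℝ) • u)) +
          ENNReal.ofReal (gaussMix P v (z + (-(m : ℝ)) • u)))) := by
    intro u z
    rw [hE, ← ENNReal.ofReal_mul (hp z).le, ← ENNReal.ofReal_add (hp _).le (hp _).le,
      ← ENNReal.ofReal_add (add_pos (hp _) (hp _)).le (hp _).le,
      ← ENNReal.ofReal_mul (by positivity),
      ← ENNReal.ofReal_add (mul_nonneg (hp z).le (sq_nonneg _))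
        (mul_nonneg (by positivity) (add_pos (add_pos (hp _) (hp _)) (hp _)).le),
      ← ENNReal.ofReal_mul (by positivity)]
    exact ENNReal.ofReal_le_ofReal (gaussMix_mul_expDefect_le P hB hv hm hτ0 hτ1 z u)
  have hshift : ∀ w : Vec d, ∫⁻ z, ENNReal.ofReal (gaussMix P v (z + w)) = 1 := fun w => by
    rw [lintegral_add_right_eq_self (fun z => ENNReal.ofReal (gaussMix P v z)) w,
      lintegral_gaussMix P hv]
  have hpw : ∀ w : Vec d, Measurable fun z => ENNReal.ofReal (gaussMix P v (z + w)) := fun w =>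
    (hpm.comp (measurable_id.add_const w)).ennreal_ofReal
  have hinner : ∀ u, ∫⁻ z, ENNReal.ofReal (gaussMix P v (z + τ • u) *
      expDefect (inner ℝ u (gaussMixScore P v z) - clip B (inner ℝ u (s z)))) ≤
      ENNReal.ofReal (Real.exp (3 * B)) * ((∫⁻ z, ENNReal.ofReal (gaussMix P v z) *
        ENNReal.ofReal (inner ℝ u (gaussMixScore P v z - s z) ^ 2)) + 3 * E u) := by
    intro u
    refine (lintegral_mono (hpt u)).trans_eq ?_
    rw [lintegral_const_mul' _ _ ENNReal.ofReal_ne_top, lintegral_add_left (by fun_prop),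
      lintegral_const_mul' _ _ ENNReal.ofReal_ne_top, lintegral_add_right _ (hpw _),
      lintegral_add_right _ (hpw _), hshift, hshift, hshift, mul_comm (E u)]
    norm_num
  refine (lintegral_mono hinner).trans ?_
  rw [lintegral_const_mul' _ _ ENNReal.ofReal_ne_top, lintegral_add_right _ (by fun_prop),
    lintegral_const_mul' _ _ (by norm_num)]
  gcongr
  · rw [lintegral_lintegral_swap (by fun_prop), ← lintegral_const_mul' _ _ ENNReal.ofReal_ne_top]
    refine lintegral_mono fun z => ?_
    rw [lintegral_const_mul' _ _ ENNReal.ofReal_ne_top, lintegral_inner_sq_isoGaussian hh.le,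
      ENNReal.ofReal_mul hh.le, norm_sub_rev]
    exact le_of_eq (mul_left_comm _ _ _)
  · have hc : 2 * ((m : ℝ) ^ 2 / (2 * v)) * h = (m : ℝ) ^ 2 * h / v := by field_simp
    calc ∫⁻ u, E u ∂γ = ENNReal.ofReal (Real.exp (-(m * B))) *
          ∫⁻ u, ENNReal.ofReal (Real.exp ((m : ℝ) ^ 2 / (2 * v) * ‖u‖ ^ 2)) ∂γ := by
          rw [← lintegral_const_mul' _ _ ENNReal.ofReal_ne_top]
          exact lintegral_congr fun u => ENNReal.ofReal_mul (Real.exp_pos _).le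
      _ ≤ ENNReal.ofReal (Real.exp (-(m * B))) *
          ENNReal.ofReal (Real.exp ((m : ℝ) ^ 2 * h / v * d)) := by
          gcongr
          rw [← hc]
          exact lintegral_exp_sq_norm_isoGaussian_le hh (by positivity) (by rw [hc]; exact hmv)
      _ ≤ ENNReal.ofReal δ := by
          rw [← ENNReal.ofReal_mul (Real.exp_pos _).le]
          exact ENNReal.ofReal_le_ofReal hδ

/-- The integrated error of one step. -/
lemma lintegral_expDefect_stepLogRatio_le {h δ : ℝ} (hh : 0 < h) {m : ℕ} (hm : 2 ≤ m)
    (hmv : (m : ℝ) ^ 2 * h / v ≤ 1 / 2)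
    (hδ : Real.exp (-(m * B)) * Real.exp ((m : ℝ) ^ 2 * h / v * d) ≤ δ) :
    ∫⁻ q : Vec d × Vec d, ENNReal.ofReal (gaussMix P v q.1 *
        expDefect (stepLogRatio B v P s q.1 q.2)) ∂((volume : Measure (Vec d)).prod (isoGaussian 0 h))
      ≤ ENNReal.ofReal (Real.exp (3 * B)) *
        (ENNReal.ofReal h * (∫⁻ z, ENNReal.ofReal (gaussMix P v z) *
          ENNReal.ofReal (‖s z - gaussMixScore P v z‖ ^ 2)) + 3 * ENNReal.ofReal δ) := by
  have hp := gaussMix_pos P hv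
  have hpm := (continuous_gaussMix P hv).measurable
  set γ := isoGaussian (0 : Vec d) h
  set I := volume.restrict (Set.Icc (0 : ℝ) 1)
  set φ : Vec d × Vec d → ℝ := fun q =>
    expDefect (inner ℝ q.2 (gaussMixScore P v q.1) - clip B (inner ℝ q.2 (s q.1))) with hφ
  have hφm : Measurable φ := measurable_expDefect_local P hv hs
  set H : (Vec d × Vec d) × ℝ → ℝ≥0∞ := fun q =>
    ENNReal.ofReal (gaussMix P v q.1.1 * φ (q.1.1 - (1 - q.2) • q.1.2, q.1.2)) with hH
  have hHm : Measurable H := by fun_prop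
  calc _ ≤ ∫⁻ q : Vec d × Vec d, ∫⁻ r, H (q, r) ∂I ∂(volume.prod γ) := by
        refine lintegral_mono fun q => ?_
        rw [ENNReal.ofReal_mul (hp _).le]
        refine (mul_le_mul_right (expDefect_stepLogRatio_le P hB hv hs q.1 q.2) _).trans_eq ?_
        rw [← lintegral_const_mul' _ _ ENNReal.ofReal_ne_top]
        exact lintegral_congr fun r => (ENNReal.ofReal_mul (hp _).le).symm
    _ = ∫⁻ r, ∫⁻ u, (∫⁻ x, H ((x, u), r)) ∂γ ∂I := by
        rw [lintegral_lintegral_swap hHm.aemeasurable]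
        refine lintegral_congr fun r => ?_
        rw [lintegral_prod_symm _ (by fun_prop)]
    _ = ∫⁻ r, ∫⁻ u, (∫⁻ z, ENNReal.ofReal (gaussMix P v (z + (1 - r) • u) * φ (z, u))) ∂γ ∂I := by
        refine lintegral_congr fun r => lintegral_congr fun u => ?_
        -- For fixed `u` and `r`, translation invariance makes the intermediate point of the segment
        -- the new integration variable.
        rw [← lintegral_add_right_eq_self _ ((1 - r) • u)]
        simp only [hH, add_sub_cancel_right]
    _ ≤ ∫⁻ _, (ENNReal.ofReal (Real.exp (3 * B)) *
        (ENNReal.ofReal h * (∫⁻ z, ENNReal.ofReal (gaussMix P v z) *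
          ENNReal.ofReal (‖s z - gaussMixScore P v z‖ ^ 2)) + 3 * ENNReal.ofReal δ)) ∂I := by
        refine lintegral_mono_ae ((ae_restrict_mem measurableSet_Icc).mono fun r hr => ?_)
        exact lintegral_shifted_expDefect_le P hB hv hs hh hm hmv hδ (by linarith [hr.2])
          (by linarith [hr.1])
    _ = _ := by rw [lintegral_const, measure_univ, mul_one]

end

/-! ### Comparison of the sampler with the reversed forward process -/

section

variable {d : ℕ} {B v h a : ℝ} (P : Measure (Vec d)) [IsProbabilityMeasure P] {s : Vec d → Vec d}

lemma gaussMix_mul_exp_neg_stepLogRatio (hv : 0 < v) (x u : Vec d) :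
    gaussMix P v x * Real.exp (-stepLogRatio B v P s x u) =
      gaussMix P v (x - u) * Real.exp (lineMean B s (x - u) x) := by
  have hp := gaussMix_pos P hv
  rw [stepLogRatio, show -(Real.log (gaussMix P v x) - Real.log (gaussMix P v (x - u)) -
    lineMean B s (x - u) x) = Real.log (gaussMix P v (x - u)) + lineMean B s (x - u) x -
      Real.log (gaussMix P v x) by ring, Real.exp_sub, Real.exp_add, Real.exp_log (hp _),
    Real.exp_log (hp _), mul_div_cancel₀ _ (hp x).ne']

/-- Integration against the unnormalised joint law of the sampler's transition, in the
coordinates `(x, x - x̄)`. -/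
lemma lintegral_unnormalised (hv : 0 < v) (hs : Measurable s) (F : Vec d × Vec d → ℝ≥0∞)
    (hF : Measurable F) :
    ∫⁻ q : Vec d × Vec d, ENNReal.ofReal (gaussMix P v q.1 *
      Real.exp (-stepLogRatio B v P s q.1 q.2)) * F q ∂(volume.prod (isoGaussian 0 h)) =
    ∫⁻ y, ENNReal.ofReal (gaussMix P v y) * ∫⁻ u, ENNReal.ofReal
      (Real.exp (lineMean B s y (y + u))) * F (y + u, u) ∂(isoGaussian 0 h) := by
  have hp := gaussMix_pos P hv
  have hpm := (continuous_gaussMix P hv).measurable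
  have hΔ := measurable_stepLogRatio (B := B) P hv hs
  have hfm : Measurable fun q : Vec d × Vec d => gaussMix P v q.1 := by fun_prop
  have hfm' : Measurable fun q : Vec d × Vec d => gaussMix P v q.2 := by fun_prop
  have hgm : Measurable fun q : Vec d × Vec d => ENNReal.ofReal (gaussMix P v q.1 *
      Real.exp (-stepLogRatio B v P s q.1 q.2)) * F q :=
    (hfm.mul hΔ.neg.exp).ennreal_ofReal.mul hF
  have hl := measurable_lineMean_comp (B := B) hs (f := fun q : Vec d × Vec d => q.2)
    (g := fun q => q.2 + q.1) (by fun_prop) (by fun_prop)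
  have hsh : Measurable fun q : Vec d × Vec d => (q.2 + q.1, q.1) := by fun_prop
  have hFs : Measurable fun q : Vec d × Vec d => F (q.2 + q.1, q.1) := hF.comp hsh
  have hm : Measurable fun q : Vec d × Vec d => ENNReal.ofReal (gaussMix P v q.2) *
      (ENNReal.ofReal (Real.exp (lineMean B s q.2 (q.2 + q.1))) * F (q.2 + q.1, q.1)) :=
    hfm'.ennreal_ofReal.mul (hl.exp.ennreal_ofReal.mul hFs)
  rw [lintegral_prod_symm _ hgm.aemeasurable]
  have h1 : ∀ u, ∫⁻ x, ENNReal.ofReal (gaussMix P v x *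
      Real.exp (-stepLogRatio B v P s x u)) * F (x, u) =
      ∫⁻ y, ENNReal.ofReal (gaussMix P v y) *
        (ENNReal.ofReal (Real.exp (lineMean B s y (y + u))) * F (y + u, u)) := by
    intro u
    rw [← lintegral_add_right_eq_self (fun x => ENNReal.ofReal (gaussMix P v x *
      Real.exp (-stepLogRatio B v P s x u)) * F (x, u)) u]
    refine lintegral_congr fun y => ?_
    rw [gaussMix_mul_exp_neg_stepLogRatio P hv, add_sub_cancel_right, ENNReal.ofReal_mul (hp _).le,
      mul_assoc]
  simp_rw [h1]
  rw [lintegral_lintegral_swap (f := fun u y => ENNReal.ofReal (gaussMix P v y) *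
    (ENNReal.ofReal (Real.exp (lineMean B s y (y + u))) * F (y + u, u))) hm.aemeasurable]
  exact lintegral_congr fun y => lintegral_const_mul' _ _ ENNReal.ofReal_ne_top

/-- The relative entropy after one step of the sampler. -/
lemma klDiv_samplerStep_le (hB : 0 < B) (hv : 0 < v) (hh : 0 ≤ h) (hs : Measurable s)
    (ha : a ≠ 0) (ν : Measure (Vec d)) [IsProbabilityMeasure ν] :
    klDiv (volume.withDensity fun x => ENNReal.ofReal (gaussMix P v x))
        (ν.bind (samplerStep B a h s)) ≤
      klDiv ((volume.withDensity fun x => ENNReal.ofReal (gaussMix P v x)).bind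
        fun x => isoGaussian (a • x) (a ^ 2 * h)) ν +
      ∫⁻ q : Vec d × Vec d, ENNReal.ofReal (gaussMix P v q.1 *
        expDefect (stepLogRatio B v P s q.1 q.2)) ∂(volume.prod (isoGaussian 0 h)) := by
  have hp := gaussMix_pos P hv
  have hpm := (continuous_gaussMix P hv).measurable
  set γ := isoGaussian (0 : Vec d) h with hγ
  set μ : Measure (Vec d) := volume.withDensity fun x => ENNReal.ofReal (gaussMix P v x) with hμ
  have : IsProbabilityMeasure μ := ⟨by
    rw [hμ, withDensity_apply _ MeasurableSet.univ, Measure.restrict_univ,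
      lintegral_gaussMix P hv]⟩
  have hκm := measurable_isoGaussian_smul (d := d) a (v := a ^ 2 * h) (by positivity)
  let κ : Kernel (Vec d) (Vec d) := ⟨fun x => isoGaussian (a • x) (a ^ 2 * h), hκm⟩
  have : IsMarkovKernel κ := ⟨fun x => isProbabilityMeasure_isoGaussian _ _⟩
  let Q : Kernel (Vec d) (Vec d) := ⟨samplerStep B a h s, measurable_samplerStep hB hh hs a⟩
  have : IsMarkovKernel Q := ⟨isProbabilityMeasure_samplerStep hB hh hs a⟩
  have hZm : Measurable (hitProb B h s) := measurable_hitProb hs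
  have hdm : Measurable fun y => ENNReal.ofReal (gaussMix P v y) *
      (ENNReal.ofReal (Real.exp B) * hitProb B h s y) := by fun_prop
  -- The weight `e^B * hitProb` cancels both the normaliser of the sampler kernel and the `e^{-B}`
  -- in the acceptance probability, so that `n ⊗ₘ Q` has an explicit density.
  set n₀ : Measure (Vec d) := volume.withDensity fun y => ENNReal.ofReal (gaussMix P v y) *
    (ENNReal.ofReal (Real.exp B) * hitProb B h s y) with hn₀_def
  have hn₀ : IsFiniteMeasure n₀ := by
    refine isFiniteMeasure_withDensity (ne_top_of_le_ne_top (b := ENNReal.ofReal (Real.exp B))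
      ENNReal.ofReal_ne_top ?_)
    calc _ ≤ ∫⁻ y, ENNReal.ofReal (gaussMix P v y) * ENNReal.ofReal (Real.exp B) := by
          refine lintegral_mono fun y => ?_
          gcongr
          exact mul_le_of_le_one_right' (hitProb_le_one hB y)
      _ = _ := by rw [lintegral_mul_const' _ _ ENNReal.ofReal_ne_top, lintegral_gaussMix P hv,
                    one_mul]
  let n : Measure (Vec d) := n₀.map (a • ·)
  have : IsFiniteMeasure n := Measure.isFiniteMeasure_map _ _
  have hΦ : Measurable fun q : Vec d × Vec d => (a • (q.1 - q.2), q.1) := by fun_prop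
  have hΔ := measurable_stepLogRatio (B := B) P hv hs
  have hfm : Measurable fun q : Vec d × Vec d => gaussMix P v q.1 := by fun_prop
  have hgm : Measurable fun q : Vec d × Vec d => ENNReal.ofReal (gaussMix P v q.1 *
      Real.exp (-stepLogRatio B v P s q.1 q.2)) := (hfm.mul hΔ.neg.exp).ennreal_ofReal
  -- Both joint laws are images under `(x, u) ↦ (a(x - u), x)` of measures with densities against
  -- the same product of Lebesgue and Gaussian measure.
  have hJ : (μ ⊗ₘ κ).map Prod.swap = ((volume.prod γ).withDensity fun q =>
      ENNReal.ofReal (gaussMix P v q.1)).map fun q => (a • (q.1 - q.2), q.1) := by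
    refine Measure.ext_of_lintegral _ fun F hF => ?_
    have hFΦ : Measurable fun q : Vec d × Vec d => F (a • (q.1 - q.2), q.1) := hF.comp hΦ
    have hF' : Measurable fun x => ∫⁻ y, F (y, x) ∂(κ x) :=
      Measurable.lintegral_kernel_prod_right' (κ := κ) (f := fun q => F (q.2, q.1)) (by fun_prop)
    rw [lintegral_map hF measurable_swap, Measure.lintegral_compProd (by fun_prop)]
    simp only [Prod.swap_prod_mk]
    rw [lintegral_map hF hΦ, lintegral_withDensity_eq_lintegral_mul _ hfm.ennreal_ofReal
        hFΦ, hμ, lintegral_withDensity_eq_lintegral_mul _ hpm.ennreal_ofReal hF',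
      lintegral_prod _ (hfm.ennreal_ofReal.mul hFΦ).aemeasurable]
    refine lintegral_congr fun x => ?_
    simp only [Pi.mul_apply]
    rw [lintegral_const_mul' _ _ ENNReal.ofReal_ne_top]
    congr 1
    change ∫⁻ y, F (y, x) ∂(isoGaussian (a • x) (a ^ 2 * h)) = _
    rw [isoGaussian_smul_eq_map_sub a x hh, lintegral_map (by fun_prop) (by fun_prop)]
  have hN : n ⊗ₘ Q = ((volume.prod γ).withDensity fun q => ENNReal.ofReal (gaussMix P v q.1 *
      Real.exp (-stepLogRatio B v P s q.1 q.2))).map fun q => (a • (q.1 - q.2), q.1) := by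
    refine Measure.ext_of_lintegral _ fun F hF => ?_
    have hFΦ : Measurable fun q : Vec d × Vec d => F (a • (q.1 - q.2), q.1) := hF.comp hΦ
    have hF' : Measurable fun x => ∫⁻ y, F (x, y) ∂(Q x) :=
      Measurable.lintegral_kernel_prod_right' (κ := Q) hF
    have hF'a : Measurable fun x => ∫⁻ y, F (a • x, y) ∂(Q (a • x)) :=
      hF'.comp (measurable_const_smul a)
    rw [Measure.lintegral_compProd hF, lintegral_map hF hΦ,
      lintegral_withDensity_eq_lintegral_mul _ hgm hFΦ, lintegral_map hF' (by fun_prop), hn₀_def,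
      lintegral_withDensity_eq_lintegral_mul _ hdm hF'a]
    simp only [Pi.mul_apply]
    rw [lintegral_unnormalised P hv hs _ hFΦ]
    refine lintegral_congr fun y => ?_
    rw [mul_assoc]
    congr 1
    change _ * ∫⁻ x, F (a • y, x) ∂(samplerStep B a h s (a • y)) = _
    rw [lintegral_samplerStep hB hh hs a (a • y) (f := fun x => F (a • y, x)) (by fun_prop),
      inv_smul_smul₀ ha, mul_assoc, ENNReal.mul_inv_cancel_left (hitProb_ne_zero hB _)
        (ne_top_of_le_ne_top ENNReal.one_ne_top (hitProb_le_one hB _)),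
      ← lintegral_const_mul' _ _ ENNReal.ofReal_ne_top]
    refine lintegral_congr fun u => ?_
    rw [← mul_assoc, ← ENNReal.ofReal_mul (Real.exp_pos _).le, ← Real.exp_add, add_sub_cancel,
      add_sub_cancel_right]
  have hmass : ∫⁻ q : Vec d × Vec d, ENNReal.ofReal (gaussMix P v q.1) ∂(volume.prod γ) ≠ ∞ := by
    rw [lintegral_prod _ (by fun_prop)]
    simp [lintegral_gaussMix P hv]
  have hmass' : ∫⁻ q : Vec d × Vec d, ENNReal.ofReal (gaussMix P v q.1 *
      Real.exp (-stepLogRatio B v P s q.1 q.2)) ∂(volume.prod γ) ≠ ∞ := by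
    have h1 := measure_ne_top (n ⊗ₘ Q) Set.univ
    rw [hN, Measure.map_apply hΦ MeasurableSet.univ, Set.preimage_univ,
      withDensity_apply _ MeasurableSet.univ, Measure.restrict_univ] at h1
    exact h1
  have : IsFiniteMeasure ((volume.prod γ).withDensity fun q : Vec d × Vec d =>
      ENNReal.ofReal (gaussMix P v q.1)) := isFiniteMeasure_withDensity hmass
  have : IsFiniteMeasure ((volume.prod γ).withDensity fun q : Vec d × Vec d =>
      ENNReal.ofReal (gaussMix P v q.1 * Real.exp (-stepLogRatio B v P s q.1 q.2))) :=
    isFiniteMeasure_withDensity hmass'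
  refine (klDiv_bind_le μ κ ν n Q).trans (add_le_add le_rfl ?_)
  rw [hJ, hN]
  refine (klDiv_map_le _ _ hΦ).trans_eq ?_
  exact klDiv_withDensity_exp (volume.prod γ) hfm hΔ (fun q => hp q.1) hmass hmass'

end

/-! ### The whole sampler -/

lemma isProbabilityMeasure_backwardLaw {d : ℕ} {B : ℝ} (hB : 0 < B) (α η : ℕ → ℝ)
    (s : ℕ → Vec d → Vec d) (hs : ∀ t, Measurable (s t)) (μ : Measure (Vec d))
    [IsProbabilityMeasure μ] (t k : ℕ) (hη : ∀ j < t + k, 0 < η j) :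
    IsProbabilityMeasure (backwardLaw B α η s μ t k) := by
  induction k generalizing t with
  | zero => assumption
  | succ k ih =>
    have := ih (t + 1) fun j hj => hη j (by omega)
    have hh := (hη t (by omega)).le
    exact isProbabilityMeasure_bind (measurable_samplerStep hB hh (hs t) (α t)).aemeasurable
      (ae_of_all _ (isProbabilityMeasure_samplerStep hB hh (hs t) (α t)))

/-- The one-step bound telescopes. The step from `t + 1` to `t` is the outermost one, so the
induction on the number of steps varies `t`. The condition `1 ≤ t` ensures positive variance, hence
a density. -/
lemma klDiv_backwardLaw_le {d : ℕ} {B δ : ℝ} (hB : 0 < B) (α η : ℕ → ℝ) (pdata : Measure (Vec d))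
    [IsProbabilityMeasure pdata] (s : ℕ → Vec d → Vec d) (hs : ∀ t, Measurable (s t))
    (μ : Measure (Vec d)) [IsProbabilityMeasure μ] {m : ℕ} (hm : 2 ≤ m) (k t : ℕ) (ht : 1 ≤ t)
    (hα : ∀ j < t + k, α j ≠ 0) (hη : ∀ j < t + k, 0 < η j)
    (hmv : ∀ j, t ≤ j → j < t + k → (m : ℝ) ^ 2 * η j / noiseVar α η j ≤ 1 / 2)
    (hδ : ∀ j, t ≤ j → j < t + k →
      Real.exp (-(m * B)) * Real.exp ((m : ℝ) ^ 2 * η j / noiseVar α η j * d) ≤ δ) :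
    klDiv (forwardLaw α η pdata t) (backwardLaw B α η s μ t k) ≤
      klDiv (forwardLaw α η pdata (t + k)) μ + ∑ j ∈ Finset.Ico t (t + k),
        ENNReal.ofReal (Real.exp (3 * B)) *
          (ENNReal.ofReal (η j) * scoreErrorSq α η pdata s j + 3 * ENNReal.ofReal δ) := by
  induction k generalizing t with
  | zero => simp [backwardLaw]
  | succ k ih =>
    have h1 := ih (t + 1) (by omega) (fun j hj => hα j (by omega)) (fun j hj => hη j (by omega))
      (fun j hj hj' => hmv j (by omega) (by omega)) (fun j hj hj' => hδ j (by omega) (by omega))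
    have hprob := isProbabilityMeasure_backwardLaw hB α η s hs μ (t + 1) k
      fun j hj => hη j (by omega)
    have hh := hη t (by omega)
    have hηt : ∀ j < t, 0 < η j := fun j hj => hη j (by omega)
    have hv := noiseVar_pos α η t ht (fun j hj => hα j (by omega)) hηt
    have : IsProbabilityMeasure (pdata.map (scale α t • ·)) :=
      Measure.isProbabilityMeasure_map (by fun_prop)
    have hlaw := forwardLaw_eq_withDensity α η pdata t hηt hv
    have h2 := klDiv_samplerStep_le (pdata.map (scale α t • ·)) hB hv hh.le (hs t)
      (hα t (by omega)) (backwardLaw B α η s μ (t + 1) k)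
    rw [← hlaw] at h2
    have h3 := lintegral_expDefect_stepLogRatio_le (pdata.map (scale α t • ·)) hB hv (hs t) hh hm
      (hmv t le_rfl (by omega)) (hδ t le_rfl (by omega))
    have h4 : ∫⁻ z, ENNReal.ofReal (gaussMix (pdata.map (scale α t • ·)) (noiseVar α η t) z) *
        ENNReal.ofReal (‖s t z - gaussMixScore (pdata.map (scale α t • ·)) (noiseVar α η t) z‖ ^ 2)
        = scoreErrorSq α η pdata s t := by
      have hm1 := (continuous_gaussMixScore (pdata.map (scale α t • ·)) hv).measurable
      have hm2 := hs t
      rw [scoreErrorSq, score_eq_gaussMixScore, hlaw, lintegral_withDensity_eq_lintegral_mul _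
        (continuous_gaussMix _ hv).measurable.ennreal_ofReal (by fun_prop)]
      rfl
    rw [h4] at h3
    refine h2.trans ((add_le_add h1 h3).trans_eq ?_)
    rw [Finset.sum_eq_sum_Ico_succ_bot (by omega : t < t + (k + 1)),
      show t + 1 + k = t + (k + 1) by omega, add_assoc, add_comm (Finset.sum _ _)]

end Diffusion

/-! ### Choice of constants and conclusion. -/

theorem theorem3 (b₁ b₂ : ℝ) (hb₁ : 0 < b₁) (hb : b₁ ≤ b₂) :
    ∃ K > (0 : ℝ), ∃ C : ℝ≥0, ∀ B ∈ Set.Icc b₁ b₂,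
      ∀ (d T : ℕ) (α η : ℕ → ℝ) (δ : ℝ)
        (pdata : Measure (Diffusion.Vec d)) (pinit : Measure (Diffusion.Vec d))
        (s : ℕ → Diffusion.Vec d → Diffusion.Vec d),
        1 ≤ T →
        IsProbabilityMeasure pdata →
        IsProbabilityMeasure pinit →
        (∀ t, Measurable (s t)) →
        (∀ t < T, α t ≠ 0) →
        (∀ t < T, 0 < η t) →
        0 < δ → δ ≤ 1 / 2 →
        (∀ t, 1 ≤ t → t < T →
          K * (d * Real.log (1 / δ) + Real.log (1 / δ) ^ 2) ≤
            Diffusion.noiseVar α η t / η t) →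
        IsProbabilityMeasure (Diffusion.backwardLaw B α η s pinit 1 (T - 1)) ∧
        klDiv (Diffusion.forwardLaw α η pdata 1) (Diffusion.backwardLaw B α η s pinit 1 (T - 1)) ≤
          C * (klDiv (Diffusion.forwardLaw α η pdata T) pinit + ENNReal.ofReal (T * δ) +
            ∑ t ∈ Finset.Ico 1 T,
              ENNReal.ofReal (η t) * Diffusion.scoreErrorSq α η pdata s t) := by
  have hlog2 : 0 < Real.log 2 := Real.log_pos one_lt_two
  -- Chosen so that `m ≤ A log(1/δ)` below: the ceiling and the added `2` cost at most `3`, absorbed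
  -- because `log(1/δ) ≥ log 2`.
  set A : ℝ := 2 / b₁ + 3 / Real.log 2 with hA
  have hA0 : 0 < A := by positivity
  refine ⟨2 * A ^ 2, by positivity, 3 * (Real.exp (3 * b₂)).toNNReal, ?_⟩
  intro B hBm d T α η δ pdata pinit s hT hpdata hpinit hs hα hη hδ0 hδ2 hK
  have hB : 0 < B := hb₁.trans_le hBm.1
  have hT1 : 1 + (T - 1) = T := by omega
  refine ⟨Diffusion.isProbabilityMeasure_backwardLaw hB α η s hs pinit 1 (T - 1)
    fun j hj => hη j (by omega), ?_⟩
  set L := Real.log (1 / δ) with hL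
  have hL2 : Real.log 2 ≤ L :=
    Real.log_le_log two_pos (by rw [le_div_iff₀ hδ0]; linarith)
  have hL0 : 0 < L := hlog2.trans_le hL2
  have hδL : δ = Real.exp (-L) := by
    rw [hL, one_div, Real.log_inv, neg_neg, Real.exp_log hδ0]
  -- Then `e^{-mB} ≤ δ²`: one factor `δ` pays for the Gaussian moment, the other remains. The added
  -- `2` ensures `2 ≤ m`.
  set m : ℕ := ⌈2 * L / B⌉₊ + 2 with hm
  have hmA : (m : ℝ) ≤ A * L := by
    have h1 := (Nat.ceil_lt_add_one (a := 2 * L / B) (by positivity)).le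
    have h2 : 2 * L / B ≤ 2 * L / b₁ := by
      gcongr; exact hBm.1
    have h3 : 3 ≤ 3 / Real.log 2 * L := by
      rw [div_mul_eq_mul_div, le_div_iff₀ hlog2]; linarith
    rw [hm, hA, add_mul, div_mul_eq_mul_div]
    push_cast
    linarith
  have hmB : 2 * L ≤ m * B := by
    have h1 := Nat.le_ceil (2 * L / B)
    rw [div_le_iff₀ hB] at h1
    rw [hm]; push_cast
    nlinarith
  have hm2 : (m : ℝ) ^ 2 ≤ A ^ 2 * L ^ 2 := by
    rw [← mul_pow]; exact pow_le_pow_left₀ (Nat.cast_nonneg _) hmA 2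
  have hv : ∀ j, 1 ≤ j → j < T → 0 < Diffusion.noiseVar α η j := fun j hj hjT =>
    Diffusion.noiseVar_pos α η j hj (fun i hi => hα i (by omega)) fun i hi => hη i (by omega)
  have hd0 : (0 : ℝ) ≤ d := Nat.cast_nonneg d
  have hmain := Diffusion.klDiv_backwardLaw_le (δ := δ) hB α η pdata s hs pinit (m := m) (by omega)
    (T - 1) 1 le_rfl (fun j hj => hα j (by omega)) (fun j hj => hη j (by omega))
    -- The `log²` part of the hypothesis, with `K = 2A²`, gives the bound `1/2`.
    (fun j hj hjT => by
      have h1 := hK j hj (by omega)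
      have h2 := hη j (by omega)
      rw [le_div_iff₀ h2] at h1
      rw [div_le_iff₀ (hv j hj (by omega))]
      have h3 : 0 ≤ A ^ 2 * (d * L) * η j := by positivity
      nlinarith [mul_le_mul_of_nonneg_right hm2 h2.le])
    -- The `d log` part bounds the exponent of the Gaussian moment by `L`, so the product is at most
    -- `e^{-2L + L} = δ`.
    (fun j hj hjT => by
      have h1 := hK j hj (by omega)
      have h2 := hη j (by omega)
      rw [le_div_iff₀ h2] at h1
      have h4 : (m : ℝ) ^ 2 * η j / Diffusion.noiseVar α η j * d ≤ L := by
        rw [div_mul_eq_mul_div, div_le_iff₀ (hv j hj (by omega))]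
        have h5 := mul_le_mul_of_nonneg_left h1 hL0.le
        have h6 := mul_le_mul_of_nonneg_right hm2 (mul_nonneg h2.le hd0)
        have h7 : 0 ≤ L * (2 * A ^ 2 * L ^ 2 * η j) := by positivity
        have h8 : 0 ≤ A ^ 2 * L ^ 2 * (η j * d) := by positivity
        nlinarith
      rw [← Real.exp_add, hδL]
      exact Real.exp_le_exp.2 (by linarith))
  rw [hT1] at hmain
  refine hmain.trans ?_
  set D := klDiv (Diffusion.forwardLaw α η pdata T) pinit
  set S := ∑ t ∈ Finset.Ico 1 T, ENNReal.ofReal (η t) * Diffusion.scoreErrorSq α η pdata s t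
  set e := ENNReal.ofReal (Real.exp (3 * b₂)) with he
  have he1 : 1 ≤ e := by
    rw [he, ENNReal.one_le_ofReal, Real.one_le_exp_iff]; linarith
  have hsum : ∑ j ∈ Finset.Ico 1 T, ENNReal.ofReal (Real.exp (3 * B)) *
      (ENNReal.ofReal (η j) * Diffusion.scoreErrorSq α η pdata s j + 3 * ENNReal.ofReal δ) ≤
      e * (S + 3 * ENNReal.ofReal (T * δ)) := by
    rw [← Finset.mul_sum, Finset.sum_add_distrib, Finset.sum_const, Nat.card_Ico]
    gcongr
    · exact ENNReal.ofReal_le_ofReal (Real.exp_le_exp.2 (by linarith [hBm.2]))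
    · rw [nsmul_eq_mul, mul_left_comm, ENNReal.ofReal_mul (Nat.cast_nonneg _),
        ENNReal.ofReal_natCast]
      gcongr
      omega
  -- The factor `3` counts the three tail terms, and `e^{3 b₂}` bounds the pointwise constant
  -- `e^{3B}`.
  have hC : ((3 * (Real.exp (3 * b₂)).toNNReal : ℝ≥0) : ℝ≥0∞) = 3 * e := by
    rw [ENNReal.coe_mul]; rfl
  rw [hC]
  have h3 : (1 : ℝ≥0∞) ≤ 3 := by norm_num
  calc _ ≤ D + e * (S + 3 * ENNReal.ofReal (T * δ)) := by gcongr
    _ ≤ 3 * e * D + (3 * e * S + 3 * e * ENNReal.ofReal (T * δ)) := by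
        refine add_le_add (le_mul_of_one_le_left' (one_le_mul h3 he1)) ?_
        rw [mul_add]
        refine add_le_add ?_ (le_of_eq (by ring))
        rw [mul_assoc]
        exact le_mul_of_one_le_left' h3
    _ = _ := by ring
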